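/- Let $G$ be a real Lie group, $H\subseteq G$ a closed subgroup with Lie algebra $\mathfrak h\subseteq\mathfrak g$, and let $G/H$ carry the smooth structure for which $\pi:G\to G/H$ is a smooth submersion. Let $\Omega$ be a $G$-invariant symplectic form on $G/H$, and fix a reductive decomposition $\mathfrak g=\mathfrak h\oplus\mathfrak m$, i.e. $\mathfrak m$ is a vector subspace complementary to $\mathfrak h$ with $\operatorname{Ad}(H)(\mathfrak m)=\mathfrak m$. Assume that $G/H$ is not locally symmetric, i.e. $[\mathfrak m,\mathfrak m]\not\subseteq\mathfrak h$. Write $x_{\mathfrak m}$ for the projection of $x\in\mathfrak g$ onto $\mathfrak m$, identify $\mathfrak m$ with $T_H(G/H)$ through $d\pi_1$, and let $\omega$ be the bilinear form on $\mathfrak m$ induced by the value of $\Omega$ at the origin $H\in G/H$. Then $\omega$ is nondegenerate, so for $a,b\in\mathbb R$ a product $L^{a,b}:\mathfrak m\times\mathfrak m\to\mathfrak m$ is defined by $$\omega\big(L^{a,b}_x(y),z\big)=a\,\omega\big([x,y]_{\mathfrak m},z\big)+b\,\omega\big([x,z]_{\mathfrak m},y\big),\qquad x,y,z\in\mathfrak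 m.$$ For all $a,b\in\mathbb R$ there is a unique $G$-invariant connection $\nabla^{a,b}$ on $G/H$ whose associated product is $L^{a,b}$, i.e. such that for all $x,y\in\mathfrak m$ the vector field $\nabla^{a,b}_{x^\#}y^\#-[x^\#,y^\#]$ has the value $L^{a,b}_x(y)$ at the origin, where $x^\#$ denotes the fundamental vector field $p\mapsto\frac{d}{dt}\big|_{t=0}\exp(tx)\cdot p$. Moreover: 1. $\nabla^{a,b}$ preserves $\Omega$ (that is, $\nabla^{a,b}\Omega=0$) if and only if $a=b$; 2. $\nabla^{a,b}$ is torsion-free if and only if $a=\tfrac{1-b}{2}$; 3. $\nabla^{a,b}$ is symplectic (that is, torsion-free and preserving $\Omega$) if and only if $a=b=\tfrac13$. -/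

import Mathlib

open scoped Manifold ContDiff

noncomputable section

namespace SymplecticReductive

/-! ### Vector fields, two-forms and connections on a manifold -/

section Manifold

variable {d : ℕ} {M : Type*} [TopologicalSpace M] [ChartedSpace (EuclideanSpace ℝ (Fin d)) M]

/-- A (not necessarily smooth) vector field on `M`. -/
abbrev VField (d : ℕ) (M : Type*) [TopologicalSpace M]
    [ChartedSpace (EuclideanSpace ℝ (Fin d)) M] : Type _ :=
  (p : M) → TangentSpace (𝓡 d) p

/-- A (not necessarily smooth) field of bilinear forms on the tangent spaces of `M`. -/
abbrev BilinField (d : ℕ) (M : Type*) [TopologicalSpace M]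
    [ChartedSpace (EuclideanSpace ℝ (Fin d)) M] : Type _ :=
  (p : M) → TangentSpace (𝓡 d) p →L[ℝ] TangentSpace (𝓡 d) p →L[ℝ] ℝ

/-- Affine connections on `M`, as covariant derivatives on the tangent bundle:
`∇ Y p v` is the value at `p` of the derivative of `Y` in the direction `v`. -/
abbrev Connection (d : ℕ) (M : Type*) [TopologicalSpace M]
    [ChartedSpace (EuclideanSpace ℝ (Fin d)) M] [IsManifold (𝓡 d) ∞ M] : Type _ :=
  CovariantDerivative (𝓡 d) (EuclideanSpace ℝ (Fin d)) (TangentSpace (𝓡 d) : M → Type _)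

/-- The vector field `Y` is of class `C^∞`. -/
def IsSmoothField [IsManifold (𝓡 d) ∞ M] (Y : VField d M) : Prop :=
  ContMDiff (𝓡 d) (𝓡 d).tangent ∞ (fun p => (⟨p, Y p⟩ : TangentBundle (𝓡 d) M))

/-- The value at `p` of the exterior derivative of the two-form `Ω` on the vector fields
`X`, `Y`, `Z`. -/
def extDerivOn (Ω : BilinField d M) (X Y Z : VField d M) (p : M) : ℝ :=
  mvfderiv (𝓡 d) (fun q => Ω q (Y q) (Z q)) p (X p)
    - mvfderiv (𝓡 d) (fun q => Ω q (X q) (Z q)) p (Y p)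
    + mvfderiv (𝓡 d) (fun q => Ω q (X q) (Y q)) p (Z p)
    - Ω p (VectorField.mlieBracket (𝓡 d) X Y p) (Z p)
    + Ω p (VectorField.mlieBracket (𝓡 d) X Z p) (Y p)
    - Ω p (VectorField.mlieBracket (𝓡 d) Y Z p) (X p)

/-- `Ω` is a symplectic form: a smooth, closed, nondegenerate two-form. -/
structure IsSymplecticForm [IsManifold (𝓡 d) ∞ M] (Ω : BilinField d M) : Prop where
  smooth : ContMDiff (𝓡 d)
    ((𝓡 d).prod 𝓘(ℝ, EuclideanSpace ℝ (Fin d) →L[ℝ] EuclideanSpace ℝ (Fin d) →L[ℝ] ℝ)) ∞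
    (fun p => Bundle.TotalSpace.mk'
      (EuclideanSpace ℝ (Fin d) →L[ℝ] EuclideanSpace ℝ (Fin d) →L[ℝ] ℝ) p (Ω p))
  alternating : ∀ (p : M) (v : TangentSpace (𝓡 d) p), Ω p v v = 0
  nondegenerate : ∀ (p : M) (v : TangentSpace (𝓡 d) p), (∀ w, Ω p v w = 0) → v = 0
  closed : ∀ X Y Z : VField d M, IsSmoothField X → IsSmoothField Y → IsSmoothField Z →
    ∀ p : M, extDerivOn Ω X Y Z p = 0

/-- `∇` preserves `Ω`, that is `∇Ω = 0`. -/
def PreservesForm [IsManifold (𝓡 d) ∞ M] (nabla : Connection d M) (Ω : BilinField d M) : Prop :=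
  ∀ Y Z : VField d M, IsSmoothField Y → IsSmoothField Z →
    ∀ (p : M) (v : TangentSpace (𝓡 d) p),
      mvfderiv (𝓡 d) (fun q => Ω q (Y q) (Z q)) p v
        - Ω p (nabla Y p v) (Z p) - Ω p (Y p) (nabla Z p v) = 0

/-- `∇` is torsion-free. -/
def IsTorsionFree [IsManifold (𝓡 d) ∞ M] (nabla : Connection d M) : Prop :=
  nabla.torsion = 0

/-- `∇` is a symplectic connection for `Ω`: it is torsion-free and preserves `Ω`. -/
def IsSymplecticConnection [IsManifold (𝓡 d) ∞ M] (nabla : Connection d M)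
    (Ω : BilinField d M) : Prop :=
  IsTorsionFree nabla ∧ PreservesForm nabla Ω

end Manifold

/-! ### Lie groups -/

section LieGroup

variable {n : ℕ} {G : Type*} [TopologicalSpace G] [ChartedSpace (EuclideanSpace ℝ (Fin n)) G]
  [Group G]

instance instLieGroupMinSmoothness [LieGroup (𝓡 n) ∞ G] :
    LieGroup (𝓡 n) (minSmoothness ℝ 3) G := by
  rw [minSmoothness_of_isRCLikeNormedField]; infer_instance

instance instFiniteDimensional : FiniteDimensional ℝ (GroupLieAlgebra (𝓡 n) G) :=
  inferInstanceAs (FiniteDimensional ℝ (EuclideanSpace ℝ (Fin n)))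

/-- The adjoint action of `g` on the Lie algebra: the derivative at `1` of `x ↦ g x g⁻¹`. -/
def Ad (g : G) : GroupLieAlgebra (𝓡 n) G →ₗ[ℝ] GroupLieAlgebra (𝓡 n) G :=
  (mfderiv (𝓡 n) (𝓡 n) (fun x : G => g * x * g⁻¹) 1 :
    EuclideanSpace ℝ (Fin n) →L[ℝ] EuclideanSpace ℝ (Fin n)).toLinearMap

/-- `x` is the velocity at `t = 0` of a smooth curve through `1` that runs in `H`. -/
def IsVelocityIn (H : Subgroup G) (x : GroupLieAlgebra (𝓡 n) G) : Prop :=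
  ∃ c : ℝ → G, ContMDiffAt 𝓘(ℝ, ℝ) (𝓡 n) ∞ c 0 ∧ (∀ᶠ t in nhds (0 : ℝ), c t ∈ H) ∧
    (⟨c 0, mfderiv 𝓘(ℝ, ℝ) (𝓡 n) c 0 (1 : ℝ)⟩ : TangentBundle (𝓡 n) G) = ⟨1, x⟩

theorem isVelocityIn_iff (H : Subgroup G) (x : GroupLieAlgebra (𝓡 n) G) :
    IsVelocityIn H x ↔ ∃ c : ℝ → G, ContMDiffAt 𝓘(ℝ, ℝ) (𝓡 n) ∞ c 0 ∧
      (∀ᶠ t in nhds (0 : ℝ), c t ∈ H) ∧ c 0 = 1 ∧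
      (mfderiv 𝓘(ℝ, ℝ) (𝓡 n) c 0 (1 : ℝ) : EuclideanSpace ℝ (Fin n)) = x := by
  refine exists_congr fun c => and_congr_right fun _ => and_congr_right fun _ => ?_
  rw [Bundle.TotalSpace.mk.injEq]
  refine and_congr_right fun _ => ?_
  exact heq_iff_eq (α := EuclideanSpace ℝ (Fin n))

/-- The Lie algebra of a subgroup `H` of `G`, as a subspace of the Lie algebra of `G`: the space
of velocities at `1` of smooth curves in `H`. -/
def lieAlgebraOf [LieGroup (𝓡 n) ∞ G] (H : Subgroup G) :
    Submodule ℝ (GroupLieAlgebra (𝓡 n) G) where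
  carrier := {x | IsVelocityIn H x}
  zero_mem' := by
    refine (isVelocityIn_iff H _).2 ⟨fun _ => 1, contMDiffAt_const, by simp [H.one_mem], rfl, ?_⟩
    rw [mfderiv_const]; rfl
  add_mem' := by
    intro x y hx hy
    obtain ⟨c, hc, hcH, hc1, rfl⟩ := (isVelocityIn_iff H x).1 hx
    obtain ⟨e, he, heH, he1, rfl⟩ := (isVelocityIn_iff H y).1 hy
    refine (isVelocityIn_iff H _).2 ⟨fun t => c t * e t, hc.mul he, ?_, by simp [hc1, he1], ?_⟩
    · filter_upwards [hcH, heH] with t h1 h2 using H.mul_mem h1 h2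
    · have hcd := hc.mdifferentiableAt (by simp)
      have hed := he.mdifferentiableAt (by simp)
      have hm : MDifferentiableAt ((𝓡 n).prod (𝓡 n)) (𝓡 n) (fun p : G × G => p.1 * p.2)
          (c 0, e 0) := (contMDiff_mul (𝓡 n) ∞).contMDiffAt.mdifferentiableAt (by simp)
      have h1 := mfderiv_comp_apply (I' := (𝓡 n).prod (𝓡 n)) (0 : ℝ) hm (hcd.prodMk hed) (1 : ℝ)
      rw [mfderiv_prod_eq_add_apply hm, hcd.mfderiv_prod hed] at h1
      have h2 : (fun z : G => z * e 0) = id := by ext z; simp [he1]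
      have h3 : (fun z : G => c 0 * z) = id := by ext z; simp [hc1]
      have key : ∀ (f : G → G) (p : G) (v : EuclideanSpace ℝ (Fin n)), f = id →
          (mfderiv (𝓡 n) (𝓡 n) f p : EuclideanSpace ℝ (Fin n) →L[ℝ] EuclideanSpace ℝ (Fin n)) v
            = v := by
        rintro _ p v rfl
        rw [mfderiv_id]; rfl
      exact h1.trans (congrArg₂ (fun v w : EuclideanSpace ℝ (Fin n) => v + w)
        (key _ (c 0) _ h2) (key _ (e 0) _ h3))
  smul_mem' := by
    intro a x hx
    obtain ⟨c, hc, hcH, hc1, rfl⟩ := (isVelocityIn_iff H x).1 hx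
    refine (isVelocityIn_iff H _).2 ⟨fun t => c (a * t), ?_, ?_, by simpa using hc1, ?_⟩
    · have h0 : ContMDiffAt 𝓘(ℝ, ℝ) (𝓡 n) ∞ c (a * 0) := by simpa using hc
      exact h0.comp (0 : ℝ) (contDiff_const.mul contDiff_id).contMDiff.contMDiffAt
    · have h0 : Filter.Tendsto (fun t : ℝ => a * t) (nhds 0) (nhds 0) := by
        exact (continuous_const_mul a).tendsto' (0 : ℝ) 0 (mul_zero a)
      exact h0.eventually hcH
    · have h0 : MDifferentiableAt 𝓘(ℝ, ℝ) (𝓡 n) c (a * 0) := by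
        simpa using hc.mdifferentiableAt (by simp)
      have h1 : HasFDerivAt (fun t : ℝ => a * t) (a • ContinuousLinearMap.id ℝ ℝ) 0 :=
        (hasFDerivAt_id (0 : ℝ)).const_mul a
      have h2 := (h0.hasMFDerivAt.comp (0 : ℝ) h1.hasMFDerivAt).mfderiv
      have h3 := congrArg (fun L : ℝ →L[ℝ] EuclideanSpace ℝ (Fin n) => L 1) h2
      have h4 : (mfderiv 𝓘(ℝ, ℝ) (𝓡 n) c (a * 0) : ℝ →L[ℝ] EuclideanSpace ℝ (Fin n)) =
          mfderiv 𝓘(ℝ, ℝ) (𝓡 n) c 0 := by rw [mul_zero]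
      refine h3.trans ?_
      change (mfderiv 𝓘(ℝ, ℝ) (𝓡 n) c (a * 0) : ℝ →L[ℝ] EuclideanSpace ℝ (Fin n)) (a • 1) = _
      rw [h4]
      exact (mfderiv 𝓘(ℝ, ℝ) (𝓡 n) c 0 : ℝ →L[ℝ] EuclideanSpace ℝ (Fin n)).map_smul a 1

end LieGroup

/-! ### Homogeneous spaces -/

section Homogeneous

variable {n d : ℕ} {G : Type*} [TopologicalSpace G] [ChartedSpace (EuclideanSpace ℝ (Fin n)) G]
  [Group G] {H : Subgroup G} [ChartedSpace (EuclideanSpace ℝ (Fin d)) (G ⧸ H)]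

/-- The form `Ω` on `G ⧸ H` is `G`-invariant. -/
def IsInvariantForm (Ω : BilinField d (G ⧸ H)) : Prop :=
  ∀ (g : G) (p : G ⧸ H) (u v : TangentSpace (𝓡 d) p),
    Ω (g • p) (mfderiv (𝓡 d) (𝓡 d) (fun q : G ⧸ H => g • q) p u)
      (mfderiv (𝓡 d) (𝓡 d) (fun q : G ⧸ H => g • q) p v) = Ω p u v

/-- The connection `∇` on `G ⧸ H` is `G`-invariant: `∇` commutes with the pullback of vector
fields under the diffeomorphisms `p ↦ g • p`. -/
def IsInvariantConnection [IsManifold (𝓡 d) ∞ (G ⧸ H)] (nabla : Connection d (G ⧸ H)) : Prop :=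
  ∀ (g : G) (Y : VField d (G ⧸ H)), IsSmoothField Y →
    ∀ (p : G ⧸ H) (v : TangentSpace (𝓡 d) p),
      mfderiv (𝓡 d) (𝓡 d) (fun q : G ⧸ H => g • q) p
          (nabla (VectorField.mpullback (𝓡 d) (𝓡 d) (fun q : G ⧸ H => g • q) Y) p v) =
        nabla Y (g • p) (mfderiv (𝓡 d) (𝓡 d) (fun q : G ⧸ H => g • q) p v)

variable (d H) in
/-- The derivative at `1` of the projection `G → G ⧸ H`, from the Lie algebra of `G` to the tangent
space at the origin. -/
def projDeriv : GroupLieAlgebra (𝓡 n) G →ₗ[ℝ] TangentSpace (𝓡 d) ((1 : G) : G ⧸ H) :=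
  (mfderiv (𝓡 n) (𝓡 d) (fun g : G => (g : G ⧸ H)) 1).toLinearMap

variable (d H) in
/-- The fundamental vector field of `x`: its value at `p` is the derivative at `1` of `g ↦ g • p`
in the direction `x`. -/
def fundamentalField (x : GroupLieAlgebra (𝓡 n) G) : VField d (G ⧸ H) := fun p =>
  (mfderiv (𝓡 n) (𝓡 d) (fun g : G => g • p) 1 :
    EuclideanSpace ℝ (Fin n) →L[ℝ] EuclideanSpace ℝ (Fin d)) x

/-- The value at the origin of `∇_{x#} y# - [x#, y#]`, where `x#` and `y#` are the fundamental
vector fields of `x` and `y`. -/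
def nomizuProduct [IsManifold (𝓡 d) ∞ (G ⧸ H)] (nabla : Connection d (G ⧸ H))
    (x y : GroupLieAlgebra (𝓡 n) G) : TangentSpace (𝓡 d) ((1 : G) : G ⧸ H) :=
  nabla (fundamentalField d H y) ((1 : G) : G ⧸ H) (fundamentalField d H x ((1 : G) : G ⧸ H))
    - VectorField.mlieBracket (𝓡 d) (fundamentalField d H x) (fundamentalField d H y)
        ((1 : G) : G ⧸ H)

/-- The product on `𝔪` associated with `∇` is `L`: under the identification of `𝔪` with the tangent
space of `G ⧸ H` at the origin, `∇_{x#} y# - [x#, y#]` has the value `L x y` at the origin. -/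
def HasProduct [IsManifold (𝓡 d) ∞ (G ⧸ H)] (nabla : Connection d (G ⧸ H))
    (𝔪 : Submodule ℝ (GroupLieAlgebra (𝓡 n) G)) (L : 𝔪 → 𝔪 → 𝔪) : Prop :=
  ∀ x y : 𝔪, nomizuProduct (n := n) nabla x y = projDeriv (n := n) d H (L x y)

/-- The bilinear form `ω` induced by `Ω` on a subspace `𝔪` of the Lie algebra of `G`, through the
derivative at `1` of the projection `G → G ⧸ H`. -/
def inducedTensor (Ω : BilinField d (G ⧸ H)) (𝔪 : Submodule ℝ (GroupLieAlgebra (𝓡 n) G)) :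
    LinearMap.BilinForm ℝ 𝔪 :=
  LinearMap.mk₂ ℝ (fun x y => Ω ((1 : G) : G ⧸ H) (projDeriv (n := n) d H x)
    (projDeriv (n := n) d H y))
    (by intros; simp) (by intros; simp) (by intros; simp) (by intros; simp)

end Homogeneous

/-! ### Reductive decompositions -/

section Reductive

variable {n : ℕ} {G : Type*} [TopologicalSpace G] [ChartedSpace (EuclideanSpace ℝ (Fin n)) G]
  [Group G] [LieGroup (𝓡 n) ∞ G] {H : Subgroup G} {𝔪 : Submodule ℝ (GroupLieAlgebra (𝓡 n) G)}

/-- `𝔤 = 𝔥 ⊕ 𝔪` is a reductive decomposition: `𝔪` is a complement of the Lie algebra `𝔥` of `H`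
and `Ad(H)(𝔪) = 𝔪`. -/
structure IsReductive (H : Subgroup G) (𝔪 : Submodule ℝ (GroupLieAlgebra (𝓡 n) G)) : Prop where
  isCompl : IsCompl (lieAlgebraOf H) 𝔪
  map_Ad : ∀ h ∈ H, 𝔪.map (Ad h) = 𝔪

/-- `[𝔪, 𝔪] ⊆ 𝔥`. -/
def IsLocallySymmetric (H : Subgroup G) (𝔪 : Submodule ℝ (GroupLieAlgebra (𝓡 n) G)) : Prop :=
  ∀ x ∈ 𝔪, ∀ y ∈ 𝔪, ⁅x, y⁆ ∈ lieAlgebraOf H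

/-- The projection `x ↦ x_𝔪` of `𝔤 = 𝔥 ⊕ 𝔪` onto `𝔪`. -/
def mProj (hr : IsReductive H 𝔪) : GroupLieAlgebra (𝓡 n) G →ₗ[ℝ] 𝔪 :=
  𝔪.projectionOnto (lieAlgebraOf H) hr.isCompl.symm

/-- The linear endomorphism `y ↦ [x, y]_𝔪` of `𝔪`. -/
def bracketM (hr : IsReductive H 𝔪) (x : 𝔪) : 𝔪 →ₗ[ℝ] 𝔪 :=
  mProj hr ∘ₗ LieAlgebra.ad ℝ (GroupLieAlgebra (𝓡 n) G) (x : GroupLieAlgebra (𝓡 n) G) ∘ₗ 𝔪.subtype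

/-- The product `L^{a,b}` on `𝔪`: `L^{a,b}_x y` is the vector of `𝔪` with
`B(L^{a,b}_x y, z) = a B([x, y]_𝔪, z) + b B([x, z]_𝔪, y)` for all `z` in `𝔪`. -/
def productL (hr : IsReductive H 𝔪) (B : LinearMap.BilinForm ℝ 𝔪) (hB : B.Nondegenerate)
    (a b : ℝ) (x y : 𝔪) : 𝔪 :=
  (B.toDual hB).symm (a • B (bracketM hr x y) + b • (B.flip y ∘ₗ bracketM hr x))

theorem bracketM_apply (hr : IsReductive H 𝔪) (x y : 𝔪) :
    bracketM hr x y = mProj hr ⁅(x : GroupLieAlgebra (𝓡 n) G), (y : GroupLieAlgebra (𝓡 n) G)⁆ :=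
  rfl

theorem productL_spec (hr : IsReductive H 𝔪) (B : LinearMap.BilinForm ℝ 𝔪) (hB : B.Nondegenerate)
    (a b : ℝ) (x y z : 𝔪) :
    B (productL hr B hB a b x y) z = a * B (bracketM hr x y) z + b * B (bracketM hr x z) y := by
  rw [productL, LinearMap.BilinForm.apply_toDual_symm_apply]
  simp

end Reductive

end SymplecticReductive

end

open SymplecticReductive

/-!
# Invariant symplectic connections on reductive homogeneous spaces

Since `G → G ⧸ H` is a submersion, it has smooth local sections. Hence `G` acts smoothly on `G ⧸ H`
(`contMDiffSMul_quotient`), and the fundamental field `x#` vanishes at the origin exactly for `x`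
in the Lie algebra of `H` (`orbitDeriv_eq_zero_iff`): the complement `𝔪` is the tangent space at
the origin. As `Ad(H)` preserves `𝔪`, the identification spreads over `G ⧸ H` to an equivariant
lift `κ` of tangent vectors to the Lie algebra, with values in the conjugates of `𝔪`
(`exists_isEquivariantLift`).

Given `κ` and an equivariant field `Λ` of products on the tangent spaces,
`∇_v Y = [(κ v)#, Y] + Λ(v, Y)` is an invariant connection (`homConnection`,
`homDeriv_pullField`). It is smooth, because in a frame translated along a local section of
`G → G ⧸ H` both `κ` and `Λ` have smooth coefficients (`contMDiff_homConnection`). Its value on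
`x#`, `y#` at the origin is `[x#, y#] + Λ(x, y)`, so it is associated with the product `Λ` on
`𝔪`. Conversely the product fixes an invariant connection: a difference of connections is
tensorial, so it is determined at the origin by the fundamental fields of `𝔪`, and elsewhere by
transitivity (`eq_of_invariant`). To obtain the prescribed product, `Λ` is defined at each point by
`Ω(Λ(v, w), u) = a Ω([v, w], u) + b Ω([v, u], w)`, where `[v, w]` is the tangent vector
`[κ v, κ w]#` (`liftBracket`); it is equivariant because `Ω` is invariant.

For the two compatibility conditions, fundamental fields satisfy `[x#, y#] = -[x, y]#`
(`mlieBracket_orbitField`), and the Lie derivative of `Ω` along them is zero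
(`tderiv_form_orbitField`). With these, `dΩ = 0` becomes the cocycle identity
`Ω([u, v], w) - Ω([u, w], v) + Ω([v, w], u) = 0` (`liftBracket_cocycle`). The torsion `T` is
`Λ(u, v) - Λ(v, u) - [u, v]`, and `∇` preserves `Ω` exactly when `Λ(u, ·)` is skew for `Ω`. By the
cocycle identity
* `Ω(Λ(u, v), w) + Ω(v, Λ(u, w)) = (b - a) Ω([v, w], u)`,
* `Ω(T(u, v), w) = (2a + b - 1) Ω([u, v], w)`.

Since `[𝔪, 𝔪]` is not contained in the Lie algebra of `H`, the bracket of lifts is not identically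
zero, and as `Ω` is nondegenerate both coefficients have to vanish.
-/

set_option linter.unusedSectionVars false

section

open VectorField Filter Topology

/-! ### Vector fields related by a map -/

section Related

variable {E F : Type*} [NormedAddCommGroup E] [NormedSpace ℝ E]
  [NormedAddCommGroup F] [NormedSpace ℝ F]

/-- If `f` relates `V` to `V'` and `W` to `W'`, it relates their brackets: the second derivatives of
`f` that appear cancel by symmetry. -/
theorem fderiv_lieBracket_of_related {f : E → F} {x : E} (hf : ContDiffAt ℝ 2 f x)
    {V W : E → E} {V' W' : F → F} (hV : DifferentiableAt ℝ V x) (hW : DifferentiableAt ℝ W x)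
    (hV' : DifferentiableAt ℝ V' (f x)) (hW' : DifferentiableAt ℝ W' (f x))
    (hVV' : ∀ᶠ y in 𝓝 x, fderiv ℝ f y (V y) = V' (f y))
    (hWW' : ∀ᶠ y in 𝓝 x, fderiv ℝ f y (W y) = W' (f y)) :
    fderiv ℝ f x (lieBracket ℝ V W x) = lieBracket ℝ V' W' (f x) := by
  have hfd : DifferentiableAt ℝ f x := hf.differentiableAt (by norm_num)
  have hf' : DifferentiableAt ℝ (fderiv ℝ f) x :=
    (hf.fderiv_right (m := 1) (by norm_num)).differentiableAt (by norm_num)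
  have key : ∀ {X : E → E} {X' : F → F}, DifferentiableAt ℝ X x → DifferentiableAt ℝ X' (f x) →
      (∀ᶠ y in 𝓝 x, fderiv ℝ f y (X y) = X' (f y)) → ∀ w : E,
      fderiv ℝ f x (fderiv ℝ X x w) = fderiv ℝ X' (f x) (fderiv ℝ f x w)
        - fderiv ℝ (fderiv ℝ f) x w (X x) := by
    intro X X' hX hX' h w
    have h1 : HasFDerivAt (fun y => fderiv ℝ f y (X y)) _ x :=
      hf'.hasFDerivAt.clm_apply hX.hasFDerivAt
    have h2 : HasFDerivAt (fun y => X' (f y)) _ x := hX'.hasFDerivAt.comp x hfd.hasFDerivAt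
    have h3 := (h1.congr_of_eventuallyEq (h.mono fun y hy => hy.symm)).unique h2
    have h4 := congrArg (fun L : E →L[ℝ] F => L w) h3
    simp at h4
    rw [← h4]; abel
  have hsymm : fderiv ℝ (fderiv ℝ f) x (V x) (W x) = fderiv ℝ (fderiv ℝ f) x (W x) (V x) :=
    (hf.isSymmSndFDerivAt (by simp)).eq _ _
  rw [lieBracket, lieBracket, map_sub, key hW hW' hWW', key hV hV' hVV', hVV'.self_of_nhds,
    hWW'.self_of_nhds, hsymm]
  abel

variable [CompleteSpace E] [CompleteSpace F]
  {H : Type*} [TopologicalSpace H] {I : ModelWithCorners ℝ E H} [I.Boundaryless]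
  {M : Type*} [TopologicalSpace M] [ChartedSpace H M] [IsManifold I 2 M]
  {H' : Type*} [TopologicalSpace H'] {J : ModelWithCorners ℝ F H'} [J.Boundaryless]
  {N : Type*} [TopologicalSpace N] [ChartedSpace H' N] [IsManifold J 2 N]

/-- The vector field `V`, read in the preferred chart at `x`. -/
noncomputable def chartField (x : M) (V : Π x : M, TangentSpace I x) : E → E :=
  fun u => mpullback 𝓘(ℝ, E) I (extChartAt I x).symm V u

omit [CompleteSpace E] in
/-- The Lie bracket at `x` is computed in the preferred chart at `x`. -/
theorem mlieBracket_eq_chartField (V W : Π x : M, TangentSpace I x) (x : M) :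
    (mfderiv I 𝓘(ℝ, E) (extChartAt I x) x : E →L[ℝ] E) (mlieBracket I V W x) =
      lieBracket ℝ (chartField x V) (chartField x W) (extChartAt I x x) := by
  rw [← mlieBracketWithin_univ, mlieBracketWithin_apply]
  simp only [I.range_eq_univ, Set.preimage_univ, Set.inter_univ, mpullbackWithin_univ]
  refine (ContinuousLinearMap.IsInvertible.self_apply_inverse
    (isInvertible_mfderiv_extChartAt (mem_extChartAt_source x)) _).trans ?_
  exact congrFun (lieBracketWithin_univ (𝕜 := ℝ) (E := E)) _

theorem differentiableAt_chartField {V : Π x : M, TangentSpace I x} {x : M}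
    (hV : MDifferentiableAt I I.tangent (fun y => (⟨y, V y⟩ : TangentBundle I M)) x) :
    DifferentiableAt ℝ (chartField x V) (extChartAt I x x) := by
  have := MDifferentiableWithinAt.differentiableWithinAt_mpullbackWithin_vectorField
    (mdifferentiableWithinAt_univ.2 hV)
  simp only [I.range_eq_univ, Set.preimage_univ, Set.inter_univ,
    mpullbackWithin_univ] at this
  exact differentiableWithinAt_univ.1 this

omit [CompleteSpace E] in
theorem mfderiv_symm_chartField (V : Π x : M, TangentSpace I x) {x : M} {u : E}
    (hu : u ∈ (extChartAt I x).target) :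
    (mfderiv 𝓘(ℝ, E) I (extChartAt I x).symm u : E →L[ℝ] E) (chartField (E := E) x V u)
      = V ((extChartAt I x).symm u) := by
  have := isInvertible_mfderivWithin_extChartAt_symm (I := I) hu
  rw [I.range_eq_univ, mfderivWithin_univ] at this
  exact ContinuousLinearMap.IsInvertible.self_apply_inverse this _

omit [CompleteSpace E] in
theorem chartField_extChartAt (V : Π x : M, TangentSpace I x) {x y : M}
    (hy : y ∈ (extChartAt I x).source) :
    chartField x V (extChartAt I x y) =
      (mfderiv I 𝓘(ℝ, E) (extChartAt I x) y : E →L[ℝ] E) (V y) := by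
  have h1 := mfderivWithin_extChartAt_symm_comp_mfderiv_extChartAt' (I := I) hy
  have h2 := mfderiv_extChartAt_comp_mfderivWithin_extChartAt_symm' (I := I) hy
  rw [I.range_eq_univ, mfderivWithin_univ] at h1 h2
  have h3 : (mfderiv 𝓘(ℝ, E) I (extChartAt I x).symm (extChartAt I x y) : E →L[ℝ] E).inverse
      = (mfderiv I 𝓘(ℝ, E) (extChartAt I x) y : E →L[ℝ] E) :=
    ContinuousLinearMap.inverse_eq (M := E) (M₂ := E) h1 h2
  have h4 : (V ((extChartAt I x).symm (extChartAt I x y)) : E) = V y := by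
    rw [(extChartAt I x).left_inv hy]
  exact (congrArg _ h4).trans (congrArg (fun L : E →L[ℝ] E => L (V y)) h3)

/-- The bracket of fields related by a map `f` of manifolds is related by `f`. Relatedness is needed
only near the point, and `f` need not be invertible, so this applies to the projections and the
multiplication of a product, and to orbit maps. -/
theorem mfderiv_mlieBracket_of_related {f : M → N} {x : M} (hf : ContMDiffAt I J 2 f x)
    {V W : Π x : M, TangentSpace I x} {V' W' : Π x : N, TangentSpace J x}
    (hV : MDifferentiableAt I I.tangent (fun y => (⟨y, V y⟩ : TangentBundle I M)) x)
    (hW : MDifferentiableAt I I.tangent (fun y => (⟨y, W y⟩ : TangentBundle I M)) x)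
    (hV' : MDifferentiableAt J J.tangent (fun y => (⟨y, V' y⟩ : TangentBundle J N)) (f x))
    (hW' : MDifferentiableAt J J.tangent (fun y => (⟨y, W' y⟩ : TangentBundle J N)) (f x))
    (hVV' : ∀ᶠ y in 𝓝 x, mfderiv I J f y (V y) = V' (f y))
    (hWW' : ∀ᶠ y in 𝓝 x, mfderiv I J f y (W y) = W' (f y)) :
    mfderiv I J f x (mlieBracket I V W x) = mlieBracket J V' W' (f x) := by
  set φ := extChartAt I x with hφ
  set ψ := extChartAt J (f x) with hψ
  let F' : E → F := ψ ∘ f ∘ φ.symm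
  have hφx : φ.symm (φ x) = x := by simp [hφ]
  have hF' : ContDiffAt ℝ 2 F' (φ x) := by
    have := (contMDiffAt_iff.1 hf).2
    rwa [I.range_eq_univ, contDiffWithinAt_univ] at this
  have hFx : F' (φ x) = ψ (f x) := by simp [F', hφx]
  have hcont : ContinuousAt φ.symm (φ x) := continuousAt_extChartAt_symm x
  have hcont' : Tendsto φ.symm (𝓝 (φ x)) (𝓝 x) := by
    have := hcont.tendsto; rwa [hφx] at this
  have htarget : ∀ᶠ u in 𝓝 (φ x), u ∈ φ.target := extChartAt_target_mem_nhds x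
  have hsource : ∀ᶠ u in 𝓝 (φ x), f (φ.symm u) ∈ ψ.source :=
    hcont'.eventually (hf.continuousAt.eventually (extChartAt_source_mem_nhds (f x)))
  have hdiff : ∀ᶠ u in 𝓝 (φ x), MDifferentiableAt I J f (φ.symm u) := by
    refine hcont'.eventually ?_
    obtain ⟨w, hw, hfw⟩ := (contMDiffAt_iff_contMDiffOn_nhds (by simp)).1 hf
    filter_upwards [eventually_mem_nhds_iff.2 hw] with y hy
    exact (hfw.contMDiffAt hy).mdifferentiableAt (by simp)
  -- the derivative of the chart representation of `f`
  have hchain : ∀ᶠ u in 𝓝 (φ x), ∀ v : E, fderiv ℝ F' u v =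
      (mfderiv J 𝓘(ℝ, F) ψ (f (φ.symm u)) : F →L[ℝ] F)
        ((mfderiv I J f (φ.symm u) : E →L[ℝ] F)
          ((mfderiv 𝓘(ℝ, E) I φ.symm u : E →L[ℝ] E) v)) := by
    filter_upwards [htarget, hsource, hdiff] with u hu hu' hu'' v
    have h1 : MDifferentiableAt 𝓘(ℝ, E) I φ.symm u := by
      have := mdifferentiableWithinAt_extChartAt_symm (I := I) hu
      rwa [I.range_eq_univ, mdifferentiableWithinAt_univ] at this
    have h2 : MDifferentiableAt J 𝓘(ℝ, F) ψ (f (φ.symm u)) :=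
      mdifferentiableAt_extChartAt (by simpa [hψ] using hu')
    have h3 := ((h2.hasMFDerivAt.comp _ hu''.hasMFDerivAt).comp u h1.hasMFDerivAt).mfderiv
    rw [← mfderiv_eq_fderiv]
    exact congrArg (fun L : E →L[ℝ] F => L v) h3
  have hrel : ∀ {X : Π x : M, TangentSpace I x} {X' : Π x : N, TangentSpace J x},
      (∀ᶠ y in 𝓝 x, mfderiv I J f y (X y) = X' (f y)) →
      ∀ᶠ u in 𝓝 (φ x), fderiv ℝ F' u (chartField (E := E) x X u) = chartField (f x) X' (F' u) := by
    intro X X' h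
    filter_upwards [htarget, hsource, hchain, hcont'.eventually h] with u hu hu' hc hXu
    rw [hc]
    refine (congrArg (fun v : E => (mfderiv J 𝓘(ℝ, F) ψ (f (φ.symm u)) : F →L[ℝ] F)
      ((mfderiv I J f (φ.symm u) : E →L[ℝ] F) v)) (mfderiv_symm_chartField X hu)).trans ?_
    refine (congrArg (mfderiv J 𝓘(ℝ, F) ψ (f (φ.symm u)) : F →L[ℝ] F) hXu).trans ?_
    exact (chartField_extChartAt X' hu').symm
  have hkey := fderiv_lieBracket_of_related hF' (differentiableAt_chartField hV)
    (differentiableAt_chartField hW) (V' := chartField (f x) V') (W' := chartField (f x) W')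
    (by rw [hFx]; exact differentiableAt_chartField hV')
    (by rw [hFx]; exact differentiableAt_chartField hW') (hrel hVV') (hrel hWW')
  -- transport the identity in the charts back to the manifolds
  rw [hFx, ← mlieBracket_eq_chartField, ← mlieBracket_eq_chartField] at hkey
  have h2 : MDifferentiableAt J 𝓘(ℝ, F) ψ (f x) := mdifferentiableAt_extChartAt (by simp)
  have h5 : (F' ∘ φ) =ᶠ[𝓝 x] ψ ∘ f := by
    filter_upwards [extChartAt_source_mem_nhds (I := I) x] with y hy
    simp only [F', Function.comp_apply]
    rw [φ.left_inv hy]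
  have h6 : HasMFDerivAt I 𝓘(ℝ, F) (F' ∘ φ) x ((fderiv ℝ F' (φ x)).comp
      (mfderiv I 𝓘(ℝ, E) φ x)) :=
    (hF'.differentiableAt (by norm_num)).hasFDerivAt.hasMFDerivAt.comp x
      (mdifferentiableAt_extChartAt (by simp)).hasMFDerivAt
  have h7 := h2.hasMFDerivAt.comp x (hf.mdifferentiableAt (by simp)).hasMFDerivAt
  have h8 := hasMFDerivAt_unique (h6.congr_of_eventuallyEq h5.symm) h7
  have h9 := congrArg (fun L : E →L[ℝ] F => L (mlieBracket I V W x)) h8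
  have h10 := h9.symm.trans hkey
  have hinj : Function.Injective (mfderiv J 𝓘(ℝ, F) ψ (f x) : F →L[ℝ] F) :=
    (isInvertible_mfderiv_extChartAt (I := J) (mem_extChartAt_source (f x))).injective
  exact hinj h10

end Related

/-! ### Derivatives of maps between manifolds -/

section TDeriv

variable {E F K : Type*} [NormedAddCommGroup E] [NormedSpace ℝ E]
  [NormedAddCommGroup F] [NormedSpace ℝ F] [NormedAddCommGroup K] [NormedSpace ℝ K]
  {H : Type*} [TopologicalSpace H] {I : ModelWithCorners ℝ E H}
  {M : Type*} [TopologicalSpace M] [ChartedSpace H M]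
  {H' : Type*} [TopologicalSpace H'] {J : ModelWithCorners ℝ F H'}
  {N : Type*} [TopologicalSpace N] [ChartedSpace H' N]
  {H'' : Type*} [TopologicalSpace H''] {L : ModelWithCorners ℝ K H''}
  {P : Type*} [TopologicalSpace P] [ChartedSpace H'' P]

variable (I J) in
/-- The derivative of a map between manifolds, as a map between the model vector spaces. Unlike
for `mfderiv`, the type does not depend on the base point, so that base points can be rewritten. -/
noncomputable def tderiv (f : M → N) (x : M) : E →L[ℝ] F := mfderiv I J f x

theorem tderiv_comp {g : N → P} {f : M → N} (x : M) (hg : MDifferentiableAt J L g (f x))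
    (hf : MDifferentiableAt I J f x) (v : E) :
    tderiv I L (fun y => g (f y)) x v = tderiv J L g (f x) (tderiv I J f x v) :=
  congrArg (fun A : E →L[ℝ] K => A v) (mfderiv_comp x hg hf)

theorem tderiv_id (x : M) (v : E) : tderiv I I (fun y : M => y) x v = v :=
  congrArg (fun A : E →L[ℝ] E => A v) (mfderiv_id (I := I) (x := x))

theorem tderiv_const (c : N) (x : M) (v : E) : tderiv I J (fun _ : M => c) x v = 0 :=
  congrArg (fun A : E →L[ℝ] F => A v) (mfderiv_const (I := I) (I' := J) (c := c) (x := x))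

theorem tderiv_congr {f g : M → N} {x : M} (h : f =ᶠ[𝓝 x] g) (v : E) :
    tderiv I J f x v = tderiv I J g x v :=
  congrArg (fun A : E →L[ℝ] F => A v) h.mfderiv_eq

variable {E' : Type*} [NormedAddCommGroup E'] [NormedSpace ℝ E']
  {H₀ : Type*} [TopologicalSpace H₀] {I₀ : ModelWithCorners ℝ E' H₀}
  {Q : Type*} [TopologicalSpace Q] [ChartedSpace H₀ Q]

theorem tderiv_prod {f : M × N → P} {p : M × N} (hf : MDifferentiableAt (I.prod J) L f p)
    (v : E × F) : tderiv (I.prod J) L f p v =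
      tderiv I L (fun y => f (y, p.2)) p.1 v.1 + tderiv J L (fun y => f (p.1, y)) p.2 v.2 :=
  mfderiv_prod_eq_add_apply (v := v) hf

/-- The chain rule for a function of two variables, as a sum of partial derivatives. -/
theorem tderiv_comp₂ {f : M × N → P} {a : Q → M} {b : Q → N} (x : Q)
    (hf : MDifferentiableAt (I.prod J) L f (a x, b x)) (ha : MDifferentiableAt I₀ I a x)
    (hb : MDifferentiableAt I₀ J b x) (v : E') :
    tderiv I₀ L (fun y => f (a y, b y)) x v =
      tderiv I L (fun y => f (y, b x)) (a x) (tderiv I₀ I a x v)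
        + tderiv J L (fun y => f (a x, y)) (b x) (tderiv I₀ J b x v) := by
  refine (tderiv_comp (J := I.prod J) (f := fun y => (a y, b y)) x hf (ha.prodMk hb) v).trans ?_
  have h1 : tderiv I₀ (I.prod J) (fun y => (a y, b y)) x v
      = (tderiv I₀ I a x v, tderiv I₀ J b x v) :=
    congrArg (fun A : E' →L[ℝ] E × F => A v) (ha.mfderiv_prod hb)
  rw [h1]
  exact tderiv_prod hf _

/-- If `f : M × N → P` is smooth, the partial derivative of `f` in the direction of a fixed vector
at a fixed point of `M` depends smoothly on the point of `N`. -/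
theorem contMDiff_partial_tderiv [IsManifold I ∞ M] [IsManifold J ∞ N] [IsManifold L ∞ P]
    {f : M × N → P} (hf : ContMDiff (I.prod J) L ∞ f) (e : M) (v : E) :
    ContMDiff J L.tangent ∞
      (fun q : N => (⟨f (e, q), tderiv I L (fun y => f (y, q)) e v⟩ : TangentBundle L P)) := by
  let F₁ : N → TangentBundle I M × TangentBundle J N := fun q =>
    (⟨e, v⟩, Bundle.TotalSpace.mk' F q (0 : TangentSpace J q))
  have S₁ : ContMDiff J (I.tangent.prod J.tangent) ∞ F₁ :=
    contMDiff_const.prodMk (Bundle.contMDiff_zeroSection ℝ (TangentSpace J))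
  have S₂ : ContMDiff (I.tangent.prod J.tangent) (I.prod J).tangent ∞
    (equivTangentBundleProd I M J N).symm := contMDiff_equivTangentBundleProd_symm
  have S₃ : ContMDiff (I.prod J).tangent L.tangent ∞ (tangentMap (I.prod J) L f) :=
    hf.contMDiff_tangentMap (m := ∞) (by simp)
  refine ((S₃.comp S₂).comp S₁).congr fun q => ?_
  have h := tderiv_prod (hf.mdifferentiable (by simp) (e, q)) ((v, 0) : E × F)
  rw [map_zero, add_zero] at h
  simp only [tangentMap, Function.comp]
  exact congrArg (fun w : K => (⟨f (e, q), w⟩ : TangentBundle L P)) h.symm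

end TDeriv

section Sum
variable {n d : ℕ} {M : Type*} [TopologicalSpace M] [ChartedSpace (EuclideanSpace ℝ (Fin d)) M]
  [IsManifold (𝓡 d) ∞ M]

theorem mlieBracket_sum_right {ι : Type*} (s : Finset ι) (X : VField d M) (W : ι → VField d M)
    {p : M} (hW : ∀ i, MDifferentiableAt (𝓡 d) (𝓡 d).tangent
      (fun q => (⟨q, W i q⟩ : TangentBundle (𝓡 d) M)) p) :
    mlieBracket (𝓡 d) X (∑ i ∈ s, W i) p = ∑ i ∈ s, mlieBracket (𝓡 d) X (W i) p := by
  classical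
  induction s using Finset.induction_on with
  | empty => simp
  | insert a s ha ih =>
    have : MDifferentiableAt (𝓡 d) (𝓡 d).tangent
      (fun q => (⟨q, (∑ i ∈ s, W i) q⟩ : TangentBundle (𝓡 d) M)) p := by
      simp only [Finset.sum_apply]
      exact MDifferentiableAt.sum_section (fun i _ => hW i)
    rw [Finset.sum_insert ha, Finset.sum_insert ha, mlieBracket_add_right (hW a) this, ih]

end Sum

/-! ### Smooth actions and their fundamental vector fields -/

section Action

variable {n d : ℕ} {G : Type*} [TopologicalSpace G] [ChartedSpace (EuclideanSpace ℝ (Fin n)) G]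
  [Group G] [LieGroup (𝓡 n) ∞ G]
  {M : Type*} [TopologicalSpace M] [ChartedSpace (EuclideanSpace ℝ (Fin d)) M]
  [MulAction G M]

/-- The derivative at `1` of the orbit map `g ↦ g • p`. -/
noncomputable def orbitDeriv (d : ℕ) {n : ℕ} (G : Type*) [TopologicalSpace G]
    [ChartedSpace (EuclideanSpace ℝ (Fin n)) G] [Group G] {M : Type*} [TopologicalSpace M]
    [ChartedSpace (EuclideanSpace ℝ (Fin d)) M] [MulAction G M] (p : M) :
    EuclideanSpace ℝ (Fin n) →L[ℝ] EuclideanSpace ℝ (Fin d) :=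
  tderiv (𝓡 n) (𝓡 d) (fun g : G => g • p) 1

/-- The derivative at `p` of the translation `q ↦ g • q`. -/
noncomputable def smulDeriv (d : ℕ) {G : Type*} [Group G] {M : Type*} [TopologicalSpace M]
    [ChartedSpace (EuclideanSpace ℝ (Fin d)) M] [MulAction G M] (g : G) (p : M) :
    EuclideanSpace ℝ (Fin d) →L[ℝ] EuclideanSpace ℝ (Fin d) :=
  tderiv (𝓡 d) (𝓡 d) (fun q : M => g • q) p

/-- The fundamental vector fields of the action of `G` on `M`, as a linear family parametrized by
the Lie algebra. -/
noncomputable def orbitField (d : ℕ) {n : ℕ} (G : Type*) [TopologicalSpace G]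
    [ChartedSpace (EuclideanSpace ℝ (Fin n)) G] [Group G] (M : Type*) [TopologicalSpace M]
    [ChartedSpace (EuclideanSpace ℝ (Fin d)) M] [MulAction G M] :
    EuclideanSpace ℝ (Fin n) →ₗ[ℝ] VField d M where
  toFun x p := orbitDeriv d G p x
  map_add' x y := funext fun p => (orbitDeriv d G p).map_add x y
  map_smul' c x := funext fun p => (orbitDeriv d G p).map_smul c x

/-- `Ad g`, as an endomorphism of the model vector space. -/
noncomputable def AdE (g : G) : EuclideanSpace ℝ (Fin n) →L[ℝ] EuclideanSpace ℝ (Fin n) :=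
  tderiv (𝓡 n) (𝓡 n) (fun x : G => g * x * g⁻¹) 1

theorem contMDiff_conj (g : G) : ContMDiff (𝓡 n) (𝓡 n) ∞ (fun x : G => g * x * g⁻¹) :=
  (contMDiff_const.mul contMDiff_id).mul contMDiff_const

theorem AdE_mul (g h : G) (x : EuclideanSpace ℝ (Fin n)) : AdE (g * h) x = AdE g (AdE h x) := by
  have h0 : (fun x : G => g * h * x * (g * h)⁻¹) = fun x => g * (h * x * h⁻¹) * g⁻¹ := by
    ext x; group
  rw [AdE, h0]
  refine (tderiv_comp (f := fun x => h * x * h⁻¹) (g := fun x => g * x * g⁻¹) 1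
    ((contMDiff_conj g).mdifferentiable (by simp) _)
    ((contMDiff_conj h).mdifferentiable (by simp) _) x).trans ?_
  rw [show h * 1 * h⁻¹ = 1 by group]; rfl

theorem AdE_one (x : EuclideanSpace ℝ (Fin n)) : AdE (1 : G) x = x := by
  have h0 : (fun x : G => 1 * x * 1⁻¹) = fun x => x := by ext x; simp
  rw [AdE, h0, tderiv_id]

theorem AdE_apply_inv (g : G) (x : EuclideanSpace ℝ (Fin n)) : AdE g (AdE g⁻¹ x) = x := by
  rw [← AdE_mul, mul_inv_cancel, AdE_one]

/-- `Ad g x` depends smoothly on `g`. -/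
theorem contMDiff_AdE (x : EuclideanSpace ℝ (Fin n)) :
    ContMDiff (𝓡 n) 𝓘(ℝ, EuclideanSpace ℝ (Fin n)) ∞ (fun g : G => AdE g x) := by
  have h1 : ContMDiff ((𝓡 n).prod (𝓡 n)) (𝓡 n) ∞ (fun p : G × G => p.2 * p.1 * p.2⁻¹) :=
    (contMDiff_snd.mul contMDiff_fst).mul contMDiff_snd.inv
  have h2 := contMDiff_partial_tderiv h1 1 x
  have h3 : ContMDiff (𝓡 n) (𝓡 n).tangent ∞
      (fun g : G => (⟨1, AdE g x⟩ : TangentBundle (𝓡 n) G)) := by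
    refine h2.congr fun g => ?_
    have : g * 1 * g⁻¹ = 1 := by group
    change (⟨1, AdE g x⟩ : TangentBundle (𝓡 n) G) = ⟨g * 1 * g⁻¹, AdE g x⟩
    rw [this]
  intro g
  have h4 := (Bundle.contMDiffAt_totalSpace.1 (h3 g)).2
  refine h4.congr_of_eventuallyEq (Eventually.of_forall fun k => ?_)
  exact ((tangentBundleCore (𝓡 n) G).coordChange_self (achart _ 1) 1 (mem_chart_source _ 1)
    (AdE k x)).symm

variable [IsManifold (𝓡 d) ∞ M] [hsm : ContMDiffSMul (𝓡 n) (𝓡 d) ∞ G M]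

variable (n) in
include hsm in
theorem contMDiff_smul_left (g : G) : ContMDiff (𝓡 d) (𝓡 d) ∞ (fun q : M => g • q) :=
  ContMDiffSMul.contMDiff_const_smul (I := 𝓡 n) g

theorem contMDiff_orbit (p : M) : ContMDiff (𝓡 n) (𝓡 d) ∞ (fun g : G => g • p) :=
  contMDiff_id.smul (I := 𝓡 n) contMDiff_const

theorem isSmoothField_orbitField (x : EuclideanSpace ℝ (Fin n)) :
    IsSmoothField (orbitField d G M x) := by
  have h := contMDiff_partial_tderiv (contMDiff_smul (I := 𝓡 n) (I' := 𝓡 d) (n := ∞) (G := G)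
    (M := M)) 1 x
  refine h.congr fun q => ?_
  change (⟨q, orbitDeriv d G q x⟩ : TangentBundle (𝓡 d) M) = ⟨(1 : G) • q, orbitDeriv d G q x⟩
  rw [one_smul]

variable (n) in
include hsm in
theorem smulDeriv_mul (g h : G) (p : M) (v : EuclideanSpace ℝ (Fin d)) :
    smulDeriv d (g * h) p v = smulDeriv d g (h • p) (smulDeriv d h p v) := by
  rw [smulDeriv, funext (fun q : M => mul_smul g h q)]
  exact tderiv_comp (f := fun q : M => h • q) (g := fun q : M => g • q) p
    ((contMDiff_smul_left n g).mdifferentiable (by simp) _)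
    ((contMDiff_smul_left n h).mdifferentiable (by simp) _) v

omit [IsManifold (𝓡 d) ∞ M] in
theorem smulDeriv_one (p : M) (v : EuclideanSpace ℝ (Fin d)) :
    smulDeriv d (1 : G) p v = v := by
  rw [smulDeriv, funext (fun q : M => one_smul G q), tderiv_id]

variable (n) in
include hsm in
theorem smulDeriv_inv_apply (g : G) (p : M) (v : EuclideanSpace ℝ (Fin d)) :
    smulDeriv d g⁻¹ (g • p) (smulDeriv d g p v) = v := by
  rw [← smulDeriv_mul n, inv_mul_cancel, smulDeriv_one]

variable (n) in
include hsm in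
theorem smulDeriv_apply_inv (g : G) (p : M) (v : EuclideanSpace ℝ (Fin d)) :
    smulDeriv d g p (smulDeriv d g⁻¹ (g • p) v) = v := by
  have := smulDeriv_mul n (d := d) g g⁻¹ (g • p) v
  rw [mul_inv_cancel, smulDeriv_one, inv_smul_smul] at this
  exact this.symm

/-- Translation by `g` carries the fundamental field of `x` to that of `Ad g x`. -/
theorem smulDeriv_orbitDeriv (g : G) (p : M) (x : EuclideanSpace ℝ (Fin n)) :
    smulDeriv d g p (orbitDeriv d G p x) = orbitDeriv d G (g • p) (AdE g x) := by
  have h0 : (fun k : G => g • k • p) = fun k => (g * k * g⁻¹) • g • p := by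
    ext k; simp [mul_smul]
  have h1 := tderiv_comp (I := 𝓡 n) (J := 𝓡 d) (L := 𝓡 d)
    (f := fun k : G => k • p) (g := fun q : M => g • q) 1
    ((contMDiff_smul_left n g).mdifferentiable (by simp) _)
    ((contMDiff_orbit p).mdifferentiable (by simp) _) x
  have h2 := tderiv_comp (I := 𝓡 n) (J := 𝓡 n) (L := 𝓡 d)
    (f := fun k : G => g * k * g⁻¹) (g := fun k : G => k • g • p) 1
    ((contMDiff_orbit (g • p)).mdifferentiable (by simp) _)
    ((contMDiff_conj g).mdifferentiable (by simp) _) x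
  rw [one_smul, h0, h2, show g * 1 * g⁻¹ = 1 by group] at h1
  exact h1.symm

variable (n) in
include hsm in
/-- The inverse of `q ↦ g • q` as a derivative, in the form used by pullbacks of fields. -/
theorem inverse_smulDeriv (g : G) (p : M) :
    (mfderiv (𝓡 d) (𝓡 d) (fun q : M => g • q) p).inverse = smulDeriv d g⁻¹ (g • p) :=
  ContinuousLinearMap.inverse_eq (M := EuclideanSpace ℝ (Fin d)) (M₂ := EuclideanSpace ℝ (Fin d))
    (ContinuousLinearMap.ext fun v => smulDeriv_apply_inv (d := d) n g p v)
    (ContinuousLinearMap.ext fun v => smulDeriv_inv_apply (d := d) n g p v)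

end Action

/-! ### Brackets of fundamental vector fields and invariant forms -/

section Frame

theorem tderiv_clm {E F : Type*} [NormedAddCommGroup E] [NormedSpace ℝ E] [NormedAddCommGroup F]
    [NormedSpace ℝ F] (L : E →L[ℝ] F) (x v : E) :
    tderiv 𝓘(ℝ, E) 𝓘(ℝ, F) (fun y => L y) x v = L v := by
  rw [tderiv, mfderiv_eq_fderiv]
  exact congrArg (fun L : E →L[ℝ] F => L v) L.fderiv

variable {n d : ℕ} {M : Type*} [TopologicalSpace M] [ChartedSpace (EuclideanSpace ℝ (Fin d)) M]
  [IsManifold (𝓡 d) ∞ M]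

theorem SymplecticReductive.IsSmoothField.mdiffAt {Y : VField d M} (hY : IsSmoothField Y) (p : M) :
    MDifferentiableAt (𝓡 d) (𝓡 d).tangent (fun q => (⟨q, Y q⟩ : TangentBundle (𝓡 d) M)) p :=
  (ContMDiff.mdifferentiable hY (by simp)) p

/-- The bracket with a field `q ↦ A (F q) q`, where `A` is a linear family of vector fields and `F`
a function into its parameter space: the Leibniz rule. -/
theorem mlieBracket_linear_family (A : EuclideanSpace ℝ (Fin n) →ₗ[ℝ] VField d M)
    (hA : ∀ x, IsSmoothField (A x)) {F : M → EuclideanSpace ℝ (Fin n)} {p : M}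
    (hF : MDifferentiableAt (𝓡 d) 𝓘(ℝ, EuclideanSpace ℝ (Fin n)) F p) (X : VField d M) :
    (mlieBracket (𝓡 d) X (fun q => A (F q) q) p : EuclideanSpace ℝ (Fin d)) =
      A (tderiv (𝓡 d) 𝓘(ℝ, EuclideanSpace ℝ (Fin n)) F p (X p)) p
        + mlieBracket (𝓡 d) X (A (F p)) p := by
  let b := EuclideanSpace.basisFun (Fin n) ℝ
  let a : Fin n → M → ℝ := fun i q => F q i
  have hsum : ∀ x : EuclideanSpace ℝ (Fin n), A x = ∑ i, x i • A (b i) := by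
    intro x
    conv_lhs => rw [← b.sum_repr x]
    simp [b]
  have ha : ∀ i, MDifferentiableAt (𝓡 d) 𝓘(ℝ, ℝ) (a i) p := fun i =>
    (EuclideanSpace.proj (𝕜 := ℝ) i).differentiableAt.mdifferentiableAt.comp p hF
  have hda : ∀ i (v : EuclideanSpace ℝ (Fin d)), tderiv (𝓡 d) 𝓘(ℝ, ℝ) (a i) p v =
      (tderiv (𝓡 d) 𝓘(ℝ, EuclideanSpace ℝ (Fin n)) F p v) i := by
    intro i v
    refine (tderiv_comp (g := EuclideanSpace.proj (𝕜 := ℝ) i) p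
      (EuclideanSpace.proj (𝕜 := ℝ) i).differentiableAt.mdifferentiableAt hF v).trans ?_
    rw [tderiv, mfderiv_eq_fderiv]
    exact congrArg (fun L : EuclideanSpace ℝ (Fin n) →L[ℝ] ℝ => L _)
      (EuclideanSpace.proj (𝕜 := ℝ) i).fderiv
  have hdiff : ∀ i, MDifferentiableAt (𝓡 d) (𝓡 d).tangent
      (fun q => (⟨q, (a i • A (b i)) q⟩ : TangentBundle (𝓡 d) M)) p := fun i =>
    (ha i).smul_section ((hA (b i)).mdiffAt p)
  have h1 : (fun q => A (F q) q) = ∑ i, a i • A (b i) := by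
    funext q
    simp only [Finset.sum_apply]
    exact (congrFun (hsum (F q)) q).trans (by simp only [Finset.sum_apply]; rfl)
  have h2 : ∀ i, (mlieBracket (𝓡 d) X (a i • A (b i)) p : EuclideanSpace ℝ (Fin d)) =
      (tderiv (𝓡 d) 𝓘(ℝ, EuclideanSpace ℝ (Fin n)) F p (X p)) i • A (b i) p
        + mlieBracket (𝓡 d) X (F p i • A (b i)) p := by
    intro i
    rw [mlieBracket_const_smul_right ((hA (b i)).mdiffAt p)]
    exact (mlieBracket_smul_right (ha i) ((hA (b i)).mdiffAt p)).trans
      (congrArg (fun c : ℝ => c • (A (b i) p : EuclideanSpace ℝ (Fin d))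
        + F p i • mlieBracket (𝓡 d) X (A (b i)) p) (hda i (X p)))
  rw [h1, mlieBracket_sum_right _ _ _ hdiff, hsum (F p), mlieBracket_sum_right, hsum]
  · rw [Finset.sum_apply]
    exact (Finset.sum_congr rfl fun i _ => h2 i).trans Finset.sum_add_distrib
  · exact fun i => mdifferentiableAt_const.smul_section ((hA (b i)).mdiffAt p)

end Frame

section Group

variable {n : ℕ} {G : Type*} [TopologicalSpace G] [ChartedSpace (EuclideanSpace ℝ (Fin n)) G]
  [Group G] [LieGroup (𝓡 n) ∞ G]

variable (G) in
/-- The Lie bracket of the Lie algebra of `G`, on the model vector space. -/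
noncomputable def brE (x y : EuclideanSpace ℝ (Fin n)) : EuclideanSpace ℝ (Fin n) :=
  Bracket.bracket (L := GroupLieAlgebra (𝓡 n) G) (M := GroupLieAlgebra (𝓡 n) G) x y

variable (G) in
/-- The left-invariant vector fields on `G`, as a linear family. -/
noncomputable def leftField : EuclideanSpace ℝ (Fin n) →ₗ[ℝ] VField n G where
  toFun x k := tderiv (𝓡 n) (𝓡 n) (fun g : G => k * g) 1 x
  map_add' x y := funext fun k => (tderiv (𝓡 n) (𝓡 n) (fun g : G => k * g) 1).map_add x y
  map_smul' c x := funext fun k => (tderiv (𝓡 n) (𝓡 n) (fun g : G => k * g) 1).map_smul c x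

theorem leftField_one (x : EuclideanSpace ℝ (Fin n)) : leftField G x 1 = x := by
  change tderiv (𝓡 n) (𝓡 n) (fun g : G => 1 * g) 1 x = x
  rw [funext (fun g : G => one_mul g), tderiv_id]

theorem isSmoothField_leftField (x : EuclideanSpace ℝ (Fin n)) : IsSmoothField (leftField G x) := by
  have h1 : ContMDiff ((𝓡 n).prod (𝓡 n)) (𝓡 n) ∞ (fun p : G × G => p.2 * p.1) :=
    contMDiff_snd.mul contMDiff_fst
  refine (contMDiff_partial_tderiv h1 1 x).congr fun q => ?_
  change (⟨q, leftField G x q⟩ : TangentBundle (𝓡 n) G) = ⟨q * 1, leftField G x q⟩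
  rw [mul_one]

theorem brE_eq (x y : EuclideanSpace ℝ (Fin n)) :
    brE G x y = mlieBracket (𝓡 n) (leftField G x) (leftField G y) 1 := rfl

theorem brE_swap (x y : EuclideanSpace ℝ (Fin n)) : brE G y x = -brE G x y := by
  rw [brE_eq, brE_eq, mlieBracket_swap_apply]; rfl

theorem orbitField_self_one (x : EuclideanSpace ℝ (Fin n)) : orbitField n G G x 1 = x := by
  change tderiv (𝓡 n) (𝓡 n) (fun g : G => g * 1) 1 x = x
  rw [funext (fun g : G => mul_one g), tderiv_id]

theorem tderiv_leftField (x : EuclideanSpace ℝ (Fin n)) (k l : G) :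
    tderiv (𝓡 n) (𝓡 n) (fun g => k * g) l (leftField G x l) = leftField G x (k * l) := by
  have h := tderiv_comp (I := 𝓡 n) (J := 𝓡 n) (L := 𝓡 n) (f := fun g => l * g)
    (g := fun g => k * g) (1 : G)
    (ContMDiff.mdifferentiable (n := ∞) (contMDiff_const.mul contMDiff_id) (by simp) _)
    (ContMDiff.mdifferentiable (n := ∞) (contMDiff_const.mul contMDiff_id) (by simp) _) x
  rw [mul_one] at h
  refine h.symm.trans ?_
  change _ = tderiv (𝓡 n) (𝓡 n) (fun g => k * l * g) 1 x
  rw [funext fun g => mul_assoc k l g]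

theorem tderiv_orbitField (x : EuclideanSpace ℝ (Fin n)) (k l : G) :
    tderiv (𝓡 n) (𝓡 n) (fun g => g * l) k (orbitField n G G x k) = orbitField n G G x (k * l) := by
  have h := tderiv_comp (I := 𝓡 n) (J := 𝓡 n) (L := 𝓡 n) (f := fun g => g * k)
    (g := fun g => g * l) (1 : G)
    (ContMDiff.mdifferentiable (n := ∞) (contMDiff_id.mul contMDiff_const) (by simp) _)
    (ContMDiff.mdifferentiable (n := ∞) (contMDiff_id.mul contMDiff_const) (by simp) _) x
  rw [one_mul] at h
  refine h.symm.trans ?_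
  change _ = tderiv (𝓡 n) (𝓡 n) (fun g => g * (k * l)) 1 x
  rw [funext fun g => mul_assoc g k l]

/-- For `G` acting on itself by left multiplication the fundamental fields are right-invariant; in
terms of the left-invariant fields, the parameter is twisted by `Ad`. -/
theorem orbitField_eq_leftField (x : EuclideanSpace ℝ (Fin n)) :
    orbitField n G G x = fun k => leftField G (AdE k⁻¹ x) k := by
  funext k
  have h := tderiv_comp (I := 𝓡 n) (J := 𝓡 n) (L := 𝓡 n) (f := fun g => k⁻¹ * g * k⁻¹⁻¹)
    (g := fun g => k * g) (1 : G)
    (ContMDiff.mdifferentiable (n := ∞) (contMDiff_const.mul contMDiff_id) (by simp) _)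
    ((contMDiff_conj k⁻¹).mdifferentiable (by simp) _) x
  rw [show k⁻¹ * 1 * k⁻¹⁻¹ = 1 by group] at h
  refine Eq.trans ?_ h
  rw [show (fun g : G => k * (k⁻¹ * g * k⁻¹⁻¹)) = fun g => g * k by ext g; simp [mul_assoc]]
  rfl

theorem mdifferentiableAt_AdE_inv (x : EuclideanSpace ℝ (Fin n)) (k : G) :
    MDifferentiableAt (𝓡 n) 𝓘(ℝ, EuclideanSpace ℝ (Fin n)) (fun k : G => AdE k⁻¹ x) k :=
  ((contMDiff_AdE x).comp (contMDiff_inv (𝓡 n) ∞)).mdifferentiable (by simp) k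

/-- Left-invariant and right-invariant vector fields commute: they are the images under the
multiplication `G × G → G` of fields on the two factors. -/
theorem mlieBracket_leftField_orbitField (x y : EuclideanSpace ℝ (Fin n)) :
    mlieBracket (𝓡 n) (leftField G x) (orbitField n G G y) (1 : G) = 0 := by
  let A : (p : G × G) → TangentSpace ((𝓡 n).prod (𝓡 n)) p := fun p =>
    ((0 : EuclideanSpace ℝ (Fin n)), leftField G x p.2)
  let B : (p : G × G) → TangentSpace ((𝓡 n).prod (𝓡 n)) p := fun p =>
    (orbitField n G G y p.1, (0 : EuclideanSpace ℝ (Fin n)))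
  have S : ContMDiff ((𝓡 n).tangent.prod (𝓡 n).tangent) ((𝓡 n).prod (𝓡 n)).tangent ∞
    (equivTangentBundleProd (𝓡 n) G (𝓡 n) G).symm := contMDiff_equivTangentBundleProd_symm
  have Z : IsSmoothField (0 : VField n G) := Bundle.contMDiff_zeroSection ℝ (TangentSpace (𝓡 n))
  have hA : MDifferentiable ((𝓡 n).prod (𝓡 n)) ((𝓡 n).prod (𝓡 n)).tangent
      (fun p => (⟨p, A p⟩ : TangentBundle ((𝓡 n).prod (𝓡 n)) (G × G))) :=
    (S.comp ((ContMDiff.comp Z contMDiff_fst).prodMk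
      (ContMDiff.comp (isSmoothField_leftField x) contMDiff_snd))).mdifferentiable (by simp)
  have hB : MDifferentiable ((𝓡 n).prod (𝓡 n)) ((𝓡 n).prod (𝓡 n)).tangent
      (fun p => (⟨p, B p⟩ : TangentBundle ((𝓡 n).prod (𝓡 n)) (G × G))) :=
    (S.comp ((ContMDiff.comp (isSmoothField_orbitField y) contMDiff_fst).prodMk
      (ContMDiff.comp Z contMDiff_snd))).mdifferentiable (by simp)
  have h1 := mfderiv_mlieBracket_of_related (I := (𝓡 n).prod (𝓡 n)) (J := 𝓡 n)
    (f := (Prod.fst : G × G → G)) (x := (1, 1)) contMDiffAt_fst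
    (hA _) (hB _) (Z.mdiffAt _) ((isSmoothField_orbitField y).mdiffAt _)
    (Eventually.of_forall fun p => by rw [mfderiv_fst]; rfl)
    (Eventually.of_forall fun p => by rw [mfderiv_fst]; rfl)
  have h2 := mfderiv_mlieBracket_of_related (I := (𝓡 n).prod (𝓡 n)) (J := 𝓡 n)
    (f := (Prod.snd : G × G → G)) (x := (1, 1)) contMDiffAt_snd
    (hA _) (hB _) ((isSmoothField_leftField x).mdiffAt _) (Z.mdiffAt _)
    (Eventually.of_forall fun p => by rw [mfderiv_snd]; rfl)
    (Eventually.of_forall fun p => by rw [mfderiv_snd]; rfl)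
  have hmul : ContMDiff ((𝓡 n).prod (𝓡 n)) (𝓡 n) ∞ (fun p : G × G => p.1 * p.2) :=
    contMDiff_mul (𝓡 n) ∞
  have hd := hmul.mdifferentiable (by simp)
  have h3 := mfderiv_mlieBracket_of_related (I := (𝓡 n).prod (𝓡 n)) (J := 𝓡 n)
    (f := fun p : G × G => p.1 * p.2) (x := (1, 1)) ((hmul.of_le ENat.LEInfty.out).contMDiffAt)
    (hA _) (hB _) ((isSmoothField_leftField x).mdiffAt _)
    ((isSmoothField_orbitField y).mdiffAt _)
    (Eventually.of_forall fun p => by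
      refine (tderiv_prod (hd p) ((0, leftField G x p.2) :
        EuclideanSpace ℝ (Fin n) × EuclideanSpace ℝ (Fin n))).trans ?_
      rw [map_zero, zero_add]
      exact tderiv_leftField x p.1 p.2)
    (Eventually.of_forall fun p => by
      refine (tderiv_prod (hd p) ((orbitField n G G y p.1, 0) :
        EuclideanSpace ℝ (Fin n) × EuclideanSpace ℝ (Fin n))).trans ?_
      rw [map_zero, add_zero]
      exact tderiv_orbitField y p.1 p.2)
  have h4 : mlieBracket ((𝓡 n).prod (𝓡 n)) A B (1, 1) = 0 := by
    rw [mfderiv_fst] at h1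
    rw [mfderiv_snd] at h2
    refine Prod.ext (h1.trans ?_) (h2.trans ?_)
    · rw [mlieBracket_zero_left]; rfl
    · rw [mlieBracket_zero_right]; rfl
  rw [h4] at h3
  have h5 : mlieBracket (𝓡 n) (leftField G x) (orbitField n G G y) ((1 : G) * 1) = 0 :=
    h3.symm.trans (ContinuousLinearMap.map_zero _)
  rwa [mul_one] at h5

/-- The derivative of `k ↦ Ad k⁻¹` at `1`. By the Leibniz rule it is the difference of the brackets
of a left-invariant field with a right-invariant and with a left-invariant one; the former is
zero. -/
theorem tderiv_AdE_inv (x y : EuclideanSpace ℝ (Fin n)) :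
    tderiv (𝓡 n) 𝓘(ℝ, EuclideanSpace ℝ (Fin n)) (fun k : G => AdE k⁻¹ y) 1 x = -brE G x y := by
  have h1 := mlieBracket_linear_family (leftField G) isSmoothField_leftField
    (F := fun k : G => AdE k⁻¹ y) (p := 1) (mdifferentiableAt_AdE_inv y 1) (leftField G x)
  rw [← orbitField_eq_leftField, mlieBracket_leftField_orbitField, leftField_one, leftField_one,
    inv_one, AdE_one, ← brE_eq] at h1
  exact eq_neg_of_add_eq_zero_left h1.symm

/-- The bracket of right-invariant fields at `1` is minus the bracket of the Lie algebra, which is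
defined through left-invariant fields. -/
theorem mlieBracket_orbitField_self (x y : EuclideanSpace ℝ (Fin n)) :
    mlieBracket (𝓡 n) (orbitField n G G x) (orbitField n G G y) (1 : G) = -brE G x y := by
  have h1 := mlieBracket_linear_family (leftField G) isSmoothField_leftField
    (F := fun k : G => AdE k⁻¹ y) (p := 1) (mdifferentiableAt_AdE_inv y 1) (orbitField n G G x)
  rw [← orbitField_eq_leftField, leftField_one, orbitField_self_one, tderiv_AdE_inv,
    inv_one, AdE_one, mlieBracket_swap_apply (V := orbitField n G G x) (W := leftField G y),
    mlieBracket_leftField_orbitField] at h1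
  refine h1.trans ?_
  rw [neg_zero]
  exact add_zero _

end Group

section Action

variable {n d : ℕ} {G : Type*} [TopologicalSpace G] [ChartedSpace (EuclideanSpace ℝ (Fin n)) G]
  [Group G] [LieGroup (𝓡 n) ∞ G]
  {M : Type*} [TopologicalSpace M] [ChartedSpace (EuclideanSpace ℝ (Fin d)) M]
  [MulAction G M] [IsManifold (𝓡 d) ∞ M] [hsm : ContMDiffSMul (𝓡 n) (𝓡 d) ∞ G M]

theorem tderiv_orbit (p : M) (k : G) (x : EuclideanSpace ℝ (Fin n)) :
    tderiv (𝓡 n) (𝓡 d) (fun g : G => g • p) k (orbitField n G G x k) =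
      orbitField d G M x (k • p) := by
  have h := tderiv_comp (I := 𝓡 n) (J := 𝓡 n) (L := 𝓡 d) (f := fun g => g * k)
    (g := fun g => g • p) (1 : G)
    ((contMDiff_orbit p).mdifferentiable (by simp) _)
    (ContMDiff.mdifferentiable (n := ∞) (contMDiff_id.mul contMDiff_const) (by simp) _) x
  rw [one_mul] at h
  refine h.symm.trans ?_
  change _ = tderiv (𝓡 n) (𝓡 d) (fun g : G => g • k • p) 1 x
  rw [funext fun g => mul_smul g k p]

/-- The bracket of two fundamental vector fields is the fundamental field of minus the bracket: the
orbit map of `p` relates right-invariant fields on `G` to fundamental fields. -/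
theorem mlieBracket_orbitField (x y : EuclideanSpace ℝ (Fin n)) (p : M) :
    (mlieBracket (𝓡 d) (orbitField d G M x) (orbitField d G M y) p : EuclideanSpace ℝ (Fin d)) =
      -orbitDeriv d G p (brE G x y) := by
  have h0 : ContMDiff (𝓡 n) (𝓡 d) 2 (fun g : G => g • p) :=
    (contMDiff_orbit p).of_le ENat.LEInfty.out
  have h := mfderiv_mlieBracket_of_related (I := 𝓡 n) (J := 𝓡 d) (f := fun g : G => g • p)
    (x := (1 : G)) h0.contMDiffAt
    ((isSmoothField_orbitField x).mdiffAt 1) ((isSmoothField_orbitField y).mdiffAt 1)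
    ((isSmoothField_orbitField x).mdiffAt _) ((isSmoothField_orbitField y).mdiffAt _)
    (Eventually.of_forall fun k => tderiv_orbit p k x)
    (Eventually.of_forall fun k => tderiv_orbit p k y)
  rw [mlieBracket_orbitField_self] at h
  have h2 : (mlieBracket (𝓡 d) (orbitField d G M x) (orbitField d G M y) ((1 : G) • p) :
      EuclideanSpace ℝ (Fin d)) = -orbitDeriv d G p (brE G x y) :=
    h.symm.trans ((orbitDeriv d G p).map_neg _)
  rwa [one_smul] at h2

/-- `Ω p` as a form on the model vector space. -/
def formE (Ω : BilinField d M) (p : M) :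
    EuclideanSpace ℝ (Fin d) →L[ℝ] EuclideanSpace ℝ (Fin d) →L[ℝ] ℝ := Ω p

omit hsm in
theorem formE_swap {Ω : BilinField d M} (hΩ : IsSymplecticForm Ω) (p : M)
    (u v : EuclideanSpace ℝ (Fin d)) : formE Ω p u v = -formE Ω p v u := by
  have h : ∀ w, formE Ω p w w = 0 := hΩ.alternating p
  have h1 := h (u + v)
  simp only [map_add, _root_.add_apply, h, zero_add, add_zero] at h1
  linarith

theorem contMDiff_form_apply {Ω : BilinField d M} (hΩ : IsSymplecticForm Ω) {Y Z : VField d M}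
    (hY : IsSmoothField Y) (hZ : IsSmoothField Z) :
    ContMDiff (𝓡 d) 𝓘(ℝ, ℝ) ∞ (fun q => formE Ω q (Y q) (Z q)) := by
  intro p
  have h := ContMDiffAt.clm_bundle_apply₂ (F₁ := EuclideanSpace ℝ (Fin d))
    (F₂ := EuclideanSpace ℝ (Fin d)) (F₃ := ℝ) (E₁ := (TangentSpace (𝓡 d) : M → Type _))
    (E₂ := (TangentSpace (𝓡 d) : M → Type _)) (E₃ := Bundle.Trivial M ℝ)
    (b := fun q : M => q) (v := Y) (w := Z) (hΩ.smooth p) (hY p) (hZ p)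
  have h2 := (Bundle.contMDiffAt_totalSpace.1 h).2
  exact h2

/-- The Lie derivative of an invariant form along a fundamental field vanishes. It is obtained by
differentiating the invariance `Ω(y#, z#)(g • p) = Ω(((Ad g⁻¹) y)#, ((Ad g⁻¹) z)#)(p)` at
`g = 1`. -/
theorem tderiv_form_orbitField {Ω : BilinField d M} (hΩ : IsSymplecticForm Ω)
    (hinv : ∀ (g : G) (p : M) (u v : EuclideanSpace ℝ (Fin d)),
      formE Ω (g • p) (smulDeriv d g p u) (smulDeriv d g p v) = formE Ω p u v)
    (x y z : EuclideanSpace ℝ (Fin n)) (p : M) :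
    tderiv (𝓡 d) 𝓘(ℝ, ℝ) (fun q => formE Ω q (orbitField d G M y q) (orbitField d G M z q)) p
      (orbitDeriv d G p x) =
    -formE Ω p (orbitDeriv d G p (brE G x y)) (orbitDeriv d G p z)
      - formE Ω p (orbitDeriv d G p y) (orbitDeriv d G p (brE G x z)) := by
  have hF := contMDiff_form_apply hΩ (isSmoothField_orbitField (G := G) (n := n) y)
    (isSmoothField_orbitField (G := G) (n := n) z)
  have h1 := tderiv_comp (I := 𝓡 n) (J := 𝓡 d) (L := 𝓘(ℝ, ℝ)) (f := fun g : G => g • p)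
    (1 : G) (hF.mdifferentiable (by simp) _) ((contMDiff_orbit p).mdifferentiable (by simp) _) x
  rw [one_smul] at h1
  refine h1.symm.trans ?_
  let B : EuclideanSpace ℝ (Fin n) →L[ℝ] EuclideanSpace ℝ (Fin n) →L[ℝ] ℝ :=
    (formE Ω p).bilinearComp (orbitDeriv d G p) (orbitDeriv d G p)
  have h2 : (fun g : G => formE Ω (g • p) (orbitField d G M y (g • p))
      (orbitField d G M z (g • p))) = fun g => B (AdE g⁻¹ y) (AdE g⁻¹ z) := by
    funext g
    change formE Ω (g • p) (orbitDeriv d G (g • p) y) (orbitDeriv d G (g • p) z) =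
      formE Ω p (orbitDeriv d G p (AdE g⁻¹ y)) (orbitDeriv d G p (AdE g⁻¹ z))
    rw [← hinv g p, smulDeriv_orbitDeriv, smulDeriv_orbitDeriv, AdE_apply_inv, AdE_apply_inv]
  rw [h2]
  have hB : Differentiable ℝ
      (fun w : EuclideanSpace ℝ (Fin n) × EuclideanSpace ℝ (Fin n) => B w.1 w.2) := by fun_prop
  have hB' : MDifferentiableAt (𝓘(ℝ, EuclideanSpace ℝ (Fin n)).prod 𝓘(ℝ, EuclideanSpace ℝ (Fin n)))
      𝓘(ℝ, ℝ) (fun w : EuclideanSpace ℝ (Fin n) × EuclideanSpace ℝ (Fin n) => B w.1 w.2)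
      (AdE (1 : G)⁻¹ y, AdE (1 : G)⁻¹ z) := by
    rw [← modelWithCornersSelf_prod, chartedSpaceSelf_prod]
    exact (hB _).mdifferentiableAt
  refine (tderiv_comp₂ (1 : G) hB' (mdifferentiableAt_AdE_inv y 1) (mdifferentiableAt_AdE_inv z 1)
    x).trans ?_
  rw [tderiv_AdE_inv, tderiv_AdE_inv, inv_one, AdE_one, AdE_one]
  refine (congrArg₂ (· + ·) (tderiv_clm (B.flip z) _ _) (tderiv_clm (B y) _ _)).trans ?_
  simp [B, sub_eq_add_neg]

/-- Closedness of an invariant symplectic form, evaluated on fundamental fields: the three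
derivative terms add up to minus twice the cocycle sum by invariance, and the bracket terms to the
cocycle sum itself. -/
theorem form_cocycle {Ω : BilinField d M} (hΩ : IsSymplecticForm Ω)
    (hinv : ∀ (g : G) (p : M) (u v : EuclideanSpace ℝ (Fin d)),
      formE Ω (g • p) (smulDeriv d g p u) (smulDeriv d g p v) = formE Ω p u v)
    (x y z : EuclideanSpace ℝ (Fin n)) (p : M) :
    formE Ω p (orbitDeriv d G p (brE G x y)) (orbitDeriv d G p z)
      - formE Ω p (orbitDeriv d G p (brE G x z)) (orbitDeriv d G p y)
      + formE Ω p (orbitDeriv d G p (brE G y z)) (orbitDeriv d G p x) = 0 := by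
  have hc : _ = (0 : ℝ) := hΩ.closed _ _ _ (isSmoothField_orbitField (G := G) x)
    (isSmoothField_orbitField (G := G) y) (isSmoothField_orbitField (G := G) z) p
  -- `e1`, `e2`, `e3` are the derivative terms of `dΩ`, and `b1`, `b2`, `b3` its bracket terms
  have e1 := tderiv_form_orbitField hΩ hinv x y z p
  have e2 := tderiv_form_orbitField hΩ hinv y x z p
  have e3 := tderiv_form_orbitField hΩ hinv z x y p
  have b1 := congrArg (fun w => formE Ω p w (orbitDeriv d G p z))
    (mlieBracket_orbitField (G := G) (M := M) x y p)
  have b2 := congrArg (fun w => formE Ω p w (orbitDeriv d G p y))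
    (mlieBracket_orbitField (G := G) (M := M) x z p)
  have b3 := congrArg (fun w => formE Ω p w (orbitDeriv d G p x))
    (mlieBracket_orbitField (G := G) (M := M) y z p)
  change tderiv (𝓡 d) 𝓘(ℝ, ℝ) (fun q => formE Ω q (orbitField d G M y q) (orbitField d G M z q)) p
      (orbitDeriv d G p x) -
    tderiv (𝓡 d) 𝓘(ℝ, ℝ) (fun q => formE Ω q (orbitField d G M x q) (orbitField d G M z q)) p
      (orbitDeriv d G p y) +
    tderiv (𝓡 d) 𝓘(ℝ, ℝ) (fun q => formE Ω q (orbitField d G M x q) (orbitField d G M y q)) p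
      (orbitDeriv d G p z) -
    formE Ω p (mlieBracket (𝓡 d) (orbitField d G M x) (orbitField d G M y) p) (orbitDeriv d G p z) +
    formE Ω p (mlieBracket (𝓡 d) (orbitField d G M x) (orbitField d G M z) p) (orbitDeriv d G p y) -
    formE Ω p (mlieBracket (𝓡 d) (orbitField d G M y) (orbitField d G M z) p) (orbitDeriv d G p x)
    = 0 at hc
  have s1 := formE_swap hΩ p (orbitDeriv d G p y) (orbitDeriv d G p (brE G x z))
  have s2 := formE_swap hΩ p (orbitDeriv d G p x) (orbitDeriv d G p (brE G y z))
  have s3 := formE_swap hΩ p (orbitDeriv d G p x) (orbitDeriv d G p (brE G z y))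
  simp only [e1, e2, e3, brE_swap x y, brE_swap x z, brE_swap y z, map_neg,
    _root_.neg_apply] at hc s3 b1 b2 b3
  rw [b1, b2, b3] at hc
  linarith

end Action

/-! ### Smooth families of linear maps -/

section Smooth

variable {n d : ℕ} {M : Type*} [TopologicalSpace M] [ChartedSpace (EuclideanSpace ℝ (Fin d)) M]
  [IsManifold (𝓡 d) ∞ M]

/-- If `A` is a linear family of smooth vector fields and `F` is a smooth function into its
parameter space, the vector field `q ↦ A (F q) q` is smooth. -/
theorem contMDiffAt_linear_family {A : EuclideanSpace ℝ (Fin n) →ₗ[ℝ] VField d M} {p : M}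
    (hA : ∀ x, ContMDiffAt (𝓡 d) (𝓡 d).tangent ∞ (fun q => (⟨q, A x q⟩ : TangentBundle (𝓡 d) M)) p)
    {F : M → EuclideanSpace ℝ (Fin n)}
    (hF : ContMDiffAt (𝓡 d) 𝓘(ℝ, EuclideanSpace ℝ (Fin n)) ∞ F p) :
    ContMDiffAt (𝓡 d) (𝓡 d).tangent ∞ (fun q => (⟨q, A (F q) q⟩ : TangentBundle (𝓡 d) M)) p := by
  let b := EuclideanSpace.basisFun (Fin n) ℝ
  have hsum : ∀ x : EuclideanSpace ℝ (Fin n), A x = ∑ i, x i • A (b i) := by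
    intro x
    conv_lhs => rw [← b.sum_repr x]
    simp [b]
  have ha : ∀ i, ContMDiffAt (𝓡 d) 𝓘(ℝ, ℝ) ∞ (fun q => F q i) p := fun i =>
    (EuclideanSpace.proj (𝕜 := ℝ) i).contDiff.contMDiff.contMDiffAt.comp p hF
  have h := ContMDiffAt.sum_section (s := Finset.univ) (fun i _ => (ha i).smul_section (hA (b i)))
  refine h.congr_of_eventuallyEq (Eventually.of_forall fun q => ?_)
  have h1 : A (F q) q = ∑ i, F q i • A (b i) q :=
    (congrFun (hsum (F q)) q).trans (by simp only [Finset.sum_apply]; rfl)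
  exact congrArg (fun v => (⟨q, v⟩ : TangentBundle (𝓡 d) M)) h1

/-- A family of continuous linear maps on a finite-dimensional space is smooth as soon as its
values on each fixed vector are. -/
theorem contMDiffAt_clm_of_apply {F : Type*} [NormedAddCommGroup F] [NormedSpace ℝ F]
    {T : M → EuclideanSpace ℝ (Fin n) →L[ℝ] F} {p : M}
    (hT : ∀ u, ContMDiffAt (𝓡 d) 𝓘(ℝ, F) ∞ (fun q => T q u) p) :
    ContMDiffAt (𝓡 d) 𝓘(ℝ, EuclideanSpace ℝ (Fin n) →L[ℝ] F) ∞ T p := by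
  let b := EuclideanSpace.basisFun (Fin n) ℝ
  have h : ContMDiffAt (𝓡 d) 𝓘(ℝ, EuclideanSpace ℝ (Fin n) →L[ℝ] F) ∞
      (fun q => ∑ i, ContinuousLinearMap.smulRightL ℝ (EuclideanSpace ℝ (Fin n)) F
        (EuclideanSpace.proj i) (T q (b i))) p :=
    ContMDiffAt.sum fun i _ => (ContinuousLinearMap.smulRightL ℝ (EuclideanSpace ℝ (Fin n)) F
        (EuclideanSpace.proj i)).contDiff.contMDiff.contMDiffAt.comp p (hT (b i))
  refine h.congr_of_eventuallyEq (Eventually.of_forall fun q => ?_)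
  ext u
  conv_lhs => rw [← b.sum_repr u]
  simp [b]

/-- A field of endomorphisms of the tangent spaces is smooth as soon as its values on a smooth
frame are. The frame is given by maps `P q` from the tangent space at `p` with `P p` the identity;
they are invertible near `p` by continuity. -/
theorem contMDiffAt_hom_of_frame {p : M}
    {A : (q : M) → TangentSpace (𝓡 d) q →L[ℝ] TangentSpace (𝓡 d) q}
    {P : M → EuclideanSpace ℝ (Fin d) →L[ℝ] EuclideanSpace ℝ (Fin d)}
    (hP : ∀ u, ContMDiffAt (𝓡 d) (𝓡 d).tangent ∞
      (fun q => (⟨q, P q u⟩ : TangentBundle (𝓡 d) M)) p)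
    (hP1 : ∀ u, P p u = u)
    (hA : ∀ u, ContMDiffAt (𝓡 d) (𝓡 d).tangent ∞
      (fun q => (⟨q, A q (P q u)⟩ : TangentBundle (𝓡 d) M)) p) :
    ContMDiffAt (𝓡 d) ((𝓡 d).prod 𝓘(ℝ, EuclideanSpace ℝ (Fin d) →L[ℝ] EuclideanSpace ℝ (Fin d))) ∞
      (fun q => (⟨q, A q⟩ : Bundle.TotalSpace (EuclideanSpace ℝ (Fin d) →L[ℝ]
        EuclideanSpace ℝ (Fin d)) fun q : M => TangentSpace (𝓡 d) q →L[ℝ] TangentSpace (𝓡 d) q))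
      p := by
  rw [contMDiffAt_hom_bundle]
  refine ⟨contMDiffAt_id, ?_⟩
  -- `R q` reads a tangent vector at `q` in the trivialization at `p`
  let t := trivializationAt (EuclideanSpace ℝ (Fin d)) (TangentSpace (𝓡 d) : M → Type _) p
  let R : M → EuclideanSpace ℝ (Fin d) →L[ℝ] EuclideanSpace ℝ (Fin d) := fun q =>
    (t.continuousLinearMapAt ℝ q : EuclideanSpace ℝ (Fin d) →L[ℝ] EuclideanSpace ℝ (Fin d))
  have ht : ∀ᶠ q in 𝓝 p, q ∈ t.baseSet :=
    t.open_baseSet.mem_nhds (FiberBundle.mem_baseSet_trivializationAt' p)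
  have hR : ∀ q ∈ t.baseSet, ∀ v : TangentSpace (𝓡 d) q, (t ⟨q, v⟩).2 = R q v := fun q hq v =>
    (t.continuousLinearMapAt_apply_of_mem ℝ hq v).symm ▸ rfl
  have key : ∀ B : M → EuclideanSpace ℝ (Fin d) →L[ℝ] EuclideanSpace ℝ (Fin d),
      (∀ u, ContMDiffAt (𝓡 d) (𝓡 d).tangent ∞
        (fun q => (⟨q, B q u⟩ : TangentBundle (𝓡 d) M)) p) →
      ContMDiffAt (𝓡 d) 𝓘(ℝ, EuclideanSpace ℝ (Fin d) →L[ℝ] EuclideanSpace ℝ (Fin d)) ∞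
        (fun q => R q ∘L B q) p := by
    intro B hB
    refine contMDiffAt_clm_of_apply fun u => ?_
    refine (Bundle.contMDiffAt_totalSpace.1 (hB u)).2.congr_of_eventuallyEq ?_
    filter_upwards [ht] with q hq using (hR q hq (B q u)).symm
  have hRP := key P hP
  have hRA := key (fun q => (A q : EuclideanSpace ℝ (Fin d) →L[ℝ] EuclideanSpace ℝ (Fin d)) ∘L P q)
    hA
  have hRp : R p ∘L P p = ContinuousLinearMap.id ℝ _ := by
    ext1 u
    refine (congrArg (R p) (hP1 u)).trans ?_
    refine (hR p (FiberBundle.mem_baseSet_trivializationAt' p) u).symm.trans ?_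
    exact (tangentBundleCore (𝓡 d) M).coordChange_self (achart _ p) p (mem_chart_source _ p) u
  have hcont : ContinuousAt (fun q => R q ∘L P q) p := hRP.continuousAt
  have hinv : ∀ᶠ q in 𝓝 p, (R q ∘L P q).IsInvertible := by
    refine hcont.eventually_mem (s := Set.range ((↑) : (EuclideanSpace ℝ (Fin d) ≃L[ℝ]
      EuclideanSpace ℝ (Fin d)) → EuclideanSpace ℝ (Fin d) →L[ℝ] EuclideanSpace ℝ (Fin d))) ?_
    rw [hRp]
    exact (ContinuousLinearEquiv.refl ℝ (EuclideanSpace ℝ (Fin d))).nhds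
  have hI : ContMDiffAt (𝓡 d) 𝓘(ℝ, EuclideanSpace ℝ (Fin d) →L[ℝ] EuclideanSpace ℝ (Fin d)) ∞
      (fun q => (R q ∘L P q).inverse) p := by
    refine ContMDiffAt.comp (I' := 𝓘(ℝ, EuclideanSpace ℝ (Fin d) →L[ℝ] EuclideanSpace ℝ (Fin d)))
      (g := ContinuousLinearMap.inverse) p ?_ hRP
    rw [hRp]
    exact (contDiffAt_map_inverse (ContinuousLinearEquiv.refl ℝ
      (EuclideanSpace ℝ (Fin d)))).contMDiffAt
  -- in the trivialization, `A q` is `(R q ∘ A q ∘ P q) ∘ (R q ∘ P q)⁻¹`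
  refine (hRA.clm_comp hI).congr_of_eventuallyEq ?_
  filter_upwards [ht, hinv] with q hq hq'
  ext1 u
  have h1 : (R q ∘L P q) ((R q ∘L P q).inverse u) = u := hq'.self_apply_inverse u
  have h2 : t.symmL ℝ q u = P q ((R q ∘L P q).inverse u) := by
    conv_lhs => rw [← h1]
    exact t.symmL_continuousLinearMapAt hq _
  exact congrArg (fun v => R q (A q v)) h2

end Smooth

/-! ### Connections given by an equivariant lift and an equivariant product -/

section Connection

variable {n d : ℕ} {G : Type*} [TopologicalSpace G] [ChartedSpace (EuclideanSpace ℝ (Fin n)) G]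
  [Group G] [LieGroup (𝓡 n) ∞ G]
  {M : Type*} [TopologicalSpace M] [ChartedSpace (EuclideanSpace ℝ (Fin d)) M]
  [MulAction G M] [IsManifold (𝓡 d) ∞ M] [hsm : ContMDiffSMul (𝓡 n) (𝓡 d) ∞ G M]

/-- A family of lifts `κ p` of the tangent vectors at `p` to the Lie algebra of `G`, equivariant
under `G`. On a reductive homogeneous space, the lift with values in the conjugates of `𝔪`. -/
structure IsEquivariantLift (G : Type*) [TopologicalSpace G]
    [ChartedSpace (EuclideanSpace ℝ (Fin n)) G] [Group G] {M : Type*} [TopologicalSpace M]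
    [ChartedSpace (EuclideanSpace ℝ (Fin d)) M] [MulAction G M]
    (κ : M → EuclideanSpace ℝ (Fin d) →L[ℝ] EuclideanSpace ℝ (Fin n)) : Prop where
  orbitDeriv_apply : ∀ p v, orbitDeriv d G p (κ p v) = v
  smulDeriv_apply : ∀ (g : G) p v, κ (g • p) (smulDeriv d g p v) = AdE g (κ p v)

/-- A family of products on the tangent spaces of `M`, equivariant under `G`. -/
def IsEquivariantProduct (G : Type*) [Group G] {M : Type*} [TopologicalSpace M]
    [ChartedSpace (EuclideanSpace ℝ (Fin d)) M] [MulAction G M]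
    (Λ : M → EuclideanSpace ℝ (Fin d) →L[ℝ] EuclideanSpace ℝ (Fin d) →L[ℝ]
      EuclideanSpace ℝ (Fin d)) : Prop :=
  ∀ (g : G) p v w,
    smulDeriv d g p (Λ p v w) = Λ (g • p) (smulDeriv d g p v) (smulDeriv d g p w)

/-- Every point of `M` has a neighbourhood whose points are reached from it by translations that
depend smoothly on the target point. -/
def HasLocalSections (n d : ℕ) (G : Type*) [TopologicalSpace G]
    [ChartedSpace (EuclideanSpace ℝ (Fin n)) G] [Group G] (M : Type*) [TopologicalSpace M]
    [ChartedSpace (EuclideanSpace ℝ (Fin d)) M] [MulAction G M] : Prop :=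
  ∀ p : M, ∃ s : M → G, ContMDiffAt (𝓡 d) (𝓡 n) ∞ s p ∧ s p = 1 ∧ ∀ᶠ q in 𝓝 p, s q • p = q

omit [IsManifold (𝓡 d) ∞ M] hsm in
/-- The bracket of two vector fields at a point, as a vector of the model space. -/
noncomputable def mlieBracketE (X Y : VField d M) (p : M) : EuclideanSpace ℝ (Fin d) :=
  mlieBracket (𝓡 d) X Y p

variable {κ : M → EuclideanSpace ℝ (Fin d) →L[ℝ] EuclideanSpace ℝ (Fin n)}
  {Λ : M → EuclideanSpace ℝ (Fin d) →L[ℝ] EuclideanSpace ℝ (Fin d) →L[ℝ]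
      EuclideanSpace ℝ (Fin d)}

variable (n G) in
include hsm in
/-- The bracket of the fundamental field of `x` with `Y`, as a linear function of `x`. -/
noncomputable def orbitBracket (Y : VField d M) : EuclideanSpace ℝ (Fin n) →ₗ[ℝ] VField d M where
  toFun x := mlieBracket (𝓡 d) (orbitField d G M x) Y
  map_add' x y := funext fun p => by
    rw [map_add]
    exact mlieBracket_add_left ((isSmoothField_orbitField x).mdiffAt p)
      ((isSmoothField_orbitField y).mdiffAt p)
  map_smul' c x := funext fun p => by
    rw [map_smul]
    exact mlieBracket_const_smul_left ((isSmoothField_orbitField x).mdiffAt p)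

variable (G) in
include hsm in
/-- The covariant derivative `∇_v Y = [(κ v)#, Y] + Λ(v, Y)`, defined for an arbitrary lift `κ` and
product `Λ`; it is a connection when `κ` is a section of the orbit derivative. -/
noncomputable def homDeriv (κ : M → EuclideanSpace ℝ (Fin d) →L[ℝ] EuclideanSpace ℝ (Fin n))
    (Λ : M → EuclideanSpace ℝ (Fin d) →L[ℝ] EuclideanSpace ℝ (Fin d) →L[ℝ]
      EuclideanSpace ℝ (Fin d)) (Y : VField d M) (p : M) :
    EuclideanSpace ℝ (Fin d) →L[ℝ] EuclideanSpace ℝ (Fin d) :=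
  LinearMap.toContinuousLinearMap
    (((LinearMap.proj (R := ℝ) (φ := fun _ : M => EuclideanSpace ℝ (Fin d)) p).comp
      (orbitBracket n G Y : EuclideanSpace ℝ (Fin n) →ₗ[ℝ] M → EuclideanSpace ℝ (Fin d))).comp
        (κ p).toLinearMap + ((Λ p).flip (Y p)).toLinearMap)

theorem homDeriv_apply (Y : VField d M) (p : M) (v : EuclideanSpace ℝ (Fin d)) :
    homDeriv G κ Λ Y p v = mlieBracketE (orbitField d G M (κ p v)) Y p + Λ p v (Y p) := rfl

variable (G) in
include hsm in
/-- The connection `∇_v Y = [(κ v)#, Y] + Λ(v, Y)`, where `κ` is an equivariant lift of tangent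
vectors to the Lie algebra and `Λ` is a product on the tangent spaces. -/
noncomputable def homConnection
    (hκ : IsEquivariantLift G κ)
    (Λ : M → EuclideanSpace ℝ (Fin d) →L[ℝ] EuclideanSpace ℝ (Fin d) →L[ℝ]
      EuclideanSpace ℝ (Fin d)) : Connection d M where
  toFun Y p := homDeriv G κ Λ Y p
  isCovariantDerivativeOnUniv :=
    { add := by
        intro Y Z p hY hZ _
        refine ContinuousLinearMap.ext fun v => ?_
        have h := mlieBracket_add_right (V := orbitField d G M (κ p v)) hY hZ
        have h2 : Λ p v ((Y + Z) p) = Λ p v (Y p) + Λ p v (Z p) := (Λ p v).map_add _ _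
        refine (congrArg₂ (fun a b : EuclideanSpace ℝ (Fin d) => a + b) h h2).trans ?_
        exact add_add_add_comm (G := EuclideanSpace ℝ (Fin d)) _ _ _ _
      leibniz := by
        intro Y f p hY hf _
        refine ContinuousLinearMap.ext fun v => ?_
        have h : (mlieBracket (𝓡 d) (orbitField d G M (κ p v)) (f • Y) p :
            EuclideanSpace ℝ (Fin d)) = (mvfderiv (𝓡 d) f p v) • Y p
              + f p • mlieBracket (𝓡 d) (orbitField d G M (κ p v)) Y p := by
          refine (mlieBracket_smul_right (V := orbitField d G M (κ p v)) hf hY).trans ?_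
          exact congrArg (fun w : EuclideanSpace ℝ (Fin d) =>
            (mvfderiv (𝓡 d) f p : EuclideanSpace ℝ (Fin d) →L[ℝ] ℝ) w •
                (Y p : EuclideanSpace ℝ (Fin d))
              + f p • (mlieBracket (𝓡 d) (orbitField d G M (κ p v)) Y p : EuclideanSpace ℝ (Fin d)))
            (hκ.orbitDeriv_apply p v)
        have h2 : Λ p v ((f • Y) p) = f p • Λ p v (Y p) := (Λ p v).map_smul _ _
        refine (congrArg₂ (fun a b : EuclideanSpace ℝ (Fin d) => a + b) h h2).trans ?_
        have aux : ∀ (c k : ℝ) (y a b : EuclideanSpace ℝ (Fin d)),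
          c • y + k • a + k • b = k • (a + b) + c • y := fun c k y a b => by module
        exact aux _ _ _ _ _ }

theorem homConnection_apply (hκ : IsEquivariantLift G κ) (Y : VField d M) (p : M)
    (v : EuclideanSpace ℝ (Fin d)) :
    homConnection G hκ Λ Y p v =
      mlieBracketE (orbitField d G M (κ p v)) Y p + Λ p v (Y p) := rfl

/-- The connection of an equivariant lift and an equivariant product is smooth: in the smooth local
frames obtained by translating a tangent space along a local section of the action, lift and
product have smooth coefficients. -/
theorem contMDiff_homConnection (hκ : IsEquivariantLift G κ) (hΛ : IsEquivariantProduct G Λ)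
    (hs : HasLocalSections n d G M) :
    CovariantDerivative.ContMDiffCovariantDerivative (homConnection G hκ Λ) ∞ := by
  refine ⟨⟨fun {Y} hY => ?_⟩⟩
  replace hY : IsSmoothField Y := contMDiffOn_univ.1 hY
  intro p _
  refine ContMDiffAt.contMDiffWithinAt ?_
  have : IsManifold (𝓡 d) (minSmoothness ℝ 2) M := by
    rw [minSmoothness_of_isRCLikeNormedField]; infer_instance
  have : IsManifold (𝓡 d) (((⊤ : ℕ∞) : WithTop ℕ∞) + 1) M := inferInstanceAs (IsManifold (𝓡 d) ∞ M)
  obtain ⟨s, hs, hs1, hsp⟩ := hs p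
  -- the frame at `q` is the translate of the tangent space at `p` by `s q`
  let P : M → EuclideanSpace ℝ (Fin d) →L[ℝ] EuclideanSpace ℝ (Fin d) :=
    fun q => smulDeriv d (s q) p
  have hAd : ∀ x, ContMDiffAt (𝓡 d) 𝓘(ℝ, EuclideanSpace ℝ (Fin n)) ∞ (fun q => AdE (s q) x) p :=
    fun x => (contMDiff_AdE x).contMDiffAt.comp p hs
  have hPκ : ∀ u, ∀ᶠ q in 𝓝 p, κ q (P q u) = AdE (s q) (κ p u) := by
    intro u
    filter_upwards [hsp] with q hq
    have := hκ.smulDeriv_apply (s q) p u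
    rwa [hq] at this
  have hP : ∀ u, ContMDiffAt (𝓡 d) (𝓡 d).tangent ∞
      (fun q => (⟨q, P q u⟩ : TangentBundle (𝓡 d) M)) p := by
    intro u
    refine (contMDiffAt_linear_family (A := orbitField d G M)
      (fun x => isSmoothField_orbitField x p) (hAd (κ p u))).congr_of_eventuallyEq ?_
    filter_upwards [hPκ u] with q hq
    refine congrArg (fun v => (⟨q, v⟩ : TangentBundle (𝓡 d) M)) ?_
    refine (hκ.orbitDeriv_apply q (P q u)).symm.trans ?_
    rw [hq]; rfl
  have hP1 : ∀ u, P p u = u := fun u => by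
    change smulDeriv d (s p) p u = u
    rw [hs1, smulDeriv_one]
  refine contMDiffAt_hom_of_frame (A := homConnection G hκ Λ Y) hP hP1 fun u => ?_
  have h1 : ContMDiffAt (𝓡 d) (𝓡 d).tangent ∞
      (fun q => (⟨q, orbitBracket n G Y (AdE (s q) (κ p u)) q⟩ : TangentBundle (𝓡 d) M)) p := by
    refine contMDiffAt_linear_family (fun x => ?_) (hAd (κ p u))
    exact ContMDiffAt.mlieBracket_vectorField (m := ⊤) (n := ⊤) (isSmoothField_orbitField x p)
      (hY p)
      (by rw [minSmoothness_of_isRCLikeNormedField]; exact le_rfl)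
  have h2 : ContMDiffAt (𝓡 d) (𝓡 d).tangent ∞
      (fun q => (⟨q, Λ q (P q u) (Y q)⟩ : TangentBundle (𝓡 d) M)) p := by
    have h3 := contMDiffAt_hom_of_frame (p := p) (A := fun q => Λ q (P q u)) hP hP1 fun w => by
      refine (hP (Λ p u w)).congr_of_eventuallyEq ?_
      filter_upwards [hsp] with q hq
      refine congrArg (fun v => (⟨q, v⟩ : TangentBundle (𝓡 d) M)) ?_
      have := hΛ (s q) p u w
      rw [hq] at this
      exact this.symm
    exact ContMDiffAt.clm_bundle_apply (E₁ := (TangentSpace (𝓡 d) : M → Type _))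
      (E₂ := (TangentSpace (𝓡 d) : M → Type _)) (b := fun q : M => q) h3 (hY p)
  refine (h1.add_section h2).congr_of_eventuallyEq ?_
  filter_upwards [hPκ u] with q hq
  refine congrArg (fun v => (⟨q, v⟩ : TangentBundle (𝓡 d) M)) ?_
  refine (homConnection_apply hκ Y q (P q u)).trans ?_
  rw [hq]; rfl

end Connection

/-! ### Invariance and uniqueness -/

section Connection

variable {n d : ℕ} {G : Type*} [TopologicalSpace G] [ChartedSpace (EuclideanSpace ℝ (Fin n)) G]
  [Group G] [LieGroup (𝓡 n) ∞ G]
  {M : Type*} [TopologicalSpace M] [ChartedSpace (EuclideanSpace ℝ (Fin d)) M]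
  [MulAction G M] [IsManifold (𝓡 d) ∞ M] [hsm : ContMDiffSMul (𝓡 n) (𝓡 d) ∞ G M]
  {κ : M → EuclideanSpace ℝ (Fin d) →L[ℝ] EuclideanSpace ℝ (Fin n)}
  {Λ : M → EuclideanSpace ℝ (Fin d) →L[ℝ] EuclideanSpace ℝ (Fin d) →L[ℝ]
      EuclideanSpace ℝ (Fin d)}

/-- The pullback of the vector field `Y` under the translation by `g`. -/
noncomputable def pullField (g : G) (Y : VField d M) : VField d M :=
  mpullback (𝓡 d) (𝓡 d) (fun q : M => g • q) Y

variable (n) in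
include hsm in
theorem pullField_apply (g : G) (Y : VField d M) (p : M) :
    pullField g Y p = smulDeriv d g⁻¹ (g • p) (Y (g • p)) :=
  congrArg (fun A : EuclideanSpace ℝ (Fin d) →L[ℝ] EuclideanSpace ℝ (Fin d) => A (Y (g • p)))
    (inverse_smulDeriv n g p)

variable (n) in
include hsm in
theorem smulDeriv_pullField (g : G) (Y : VField d M) (p : M) :
    smulDeriv d g p (pullField g Y p) = Y (g • p) := by
  rw [pullField_apply n]
  exact smulDeriv_apply_inv n g p _

variable (n) in
include hsm in
theorem isSmoothField_pullField (g : G) {Y : VField d M} (hY : IsSmoothField Y) :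
    IsSmoothField (pullField g Y) := by
  have h1 := (contMDiff_smul_left (M := M) (d := d) n g⁻¹).contMDiff_tangentMap (m := ∞) (by simp)
  refine ((h1.comp hY).comp (contMDiff_smul_left n g)).congr fun q => ?_
  simp only [tangentMap, Function.comp]
  have : ∀ q', q' = q → ∀ w, (⟨q, pullField g Y q⟩ : TangentBundle (𝓡 d) M).2 = w →
      (⟨q, pullField g Y q⟩ : TangentBundle (𝓡 d) M) = ⟨q', w⟩ := by
    rintro _ rfl w rfl; rfl
  exact this _ (inv_smul_smul g q) _ (pullField_apply n g Y q)

/-- The connection of an equivariant lift and an equivariant product is invariant. -/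
theorem homDeriv_pullField (hκ : IsEquivariantLift G κ) (hΛ : IsEquivariantProduct G Λ)
    (g : G) {Y : VField d M} (hY : IsSmoothField Y) (p : M) (v : EuclideanSpace ℝ (Fin d)) :
    smulDeriv d g p (homDeriv G κ Λ (pullField g Y) p v) =
      homDeriv G κ Λ Y (g • p) (smulDeriv d g p v) := by
  have h0 : ContMDiff (𝓡 d) (𝓡 d) 2 (fun q : M => g • q) :=
    (contMDiff_smul_left n g).of_le ENat.LEInfty.out
  have h1 := mfderiv_mlieBracket_of_related (I := 𝓡 d) (J := 𝓡 d) (f := fun q : M => g • q)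
    (x := p) h0.contMDiffAt
    ((isSmoothField_orbitField (G := G) (κ p v)).mdiffAt p)
    ((isSmoothField_pullField n g hY).mdiffAt p)
    ((isSmoothField_orbitField (G := G) (AdE g (κ p v))).mdiffAt _) (hY.mdiffAt _)
    (Eventually.of_forall fun q => smulDeriv_orbitDeriv g q (κ p v))
    (Eventually.of_forall fun q => smulDeriv_pullField n g Y q)
  rw [homDeriv_apply, homDeriv_apply, map_add, hκ.smulDeriv_apply]
  exact congrArg₂ (fun a b : EuclideanSpace ℝ (Fin d) => a + b) h1 ((hΛ g p v _).trans
    (congrArg (Λ (g • p) (smulDeriv d g p v)) (smulDeriv_pullField n g Y p)))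

variable (n) in
include hsm in
/-- Two invariant connections on a transitive `G`-manifold agree if their values at one point on
fundamental fields spanning the tangent space agree. -/
theorem eq_of_invariant [MulAction.IsPretransitive G M] {nabla nabla' : Connection d M} {o : M}
    (h : ∀ (g : G) (Y : VField d M), IsSmoothField Y → ∀ (p : M) (v : EuclideanSpace ℝ (Fin d)),
      smulDeriv d g p (nabla (pullField g Y) p v) = nabla Y (g • p) (smulDeriv d g p v))
    (h' : ∀ (g : G) (Y : VField d M), IsSmoothField Y → ∀ (p : M) (v : EuclideanSpace ℝ (Fin d)),
      smulDeriv d g p (nabla' (pullField g Y) p v) = nabla' Y (g • p) (smulDeriv d g p v))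
    (ho : ∀ v : EuclideanSpace ℝ (Fin d), ∃ x : EuclideanSpace ℝ (Fin n), orbitDeriv d G o x = v ∧
      nabla (orbitField d G M x) o = nabla' (orbitField d G M x) o)
    {Y : VField d M} (hY : IsSmoothField Y) : nabla Y = nabla' Y := by
  have key : ∀ Z : VField d M, IsSmoothField Z → nabla Z o = nabla' Z o := by
    intro Z hZ
    obtain ⟨x, hx, hx'⟩ := ho (Z o)
    have e1 := IsCovariantDerivativeOn.difference_apply nabla.isCovariantDerivativeOnUniv
      nabla'.isCovariantDerivativeOnUniv (x := o) (Set.mem_univ o) (hZ.mdiffAt o)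
    have e2 := IsCovariantDerivativeOn.difference_apply nabla.isCovariantDerivativeOnUniv
      nabla'.isCovariantDerivativeOnUniv (x := o) (Set.mem_univ o)
      ((isSmoothField_orbitField (G := G) (M := M) x).mdiffAt o)
    have e3 : orbitField d G M x o = Z o := hx
    rw [e3, e1] at e2
    exact sub_eq_zero.1 (e2.trans (sub_eq_zero.2 hx'))
  funext p
  obtain ⟨g, rfl⟩ := MulAction.exists_smul_eq G o p
  refine ContinuousLinearMap.ext fun v => ?_
  have e1 := h g Y hY o (smulDeriv d g⁻¹ (g • o) v)
  have e2 := h' g Y hY o (smulDeriv d g⁻¹ (g • o) v)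
  rw [key _ (isSmoothField_pullField n g hY)] at e1
  have e3 := smulDeriv_apply_inv (d := d) n g o v
  exact (congrArg (fun w : EuclideanSpace ℝ (Fin d) => nabla Y (g • o) w) e3).symm.trans
    ((e1.symm.trans e2).trans
      (congrArg (fun w : EuclideanSpace ℝ (Fin d) => nabla' Y (g • o) w) e3))

/-! ### Torsion and compatibility with an invariant form -/

theorem homDeriv_orbitField (x : EuclideanSpace ℝ (Fin n)) (p : M)
    (v : EuclideanSpace ℝ (Fin d)) :
    homDeriv G κ Λ (orbitField d G M x) p v =
      -orbitDeriv d G p (brE G (κ p v) x) + Λ p v (orbitDeriv d G p x) := by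
  rw [homDeriv_apply]
  exact congrArg₂ (· + ·) (mlieBracket_orbitField (κ p v) x p) rfl

/-- The torsion, computed on the fundamental fields of the lifts. -/
theorem torsion_homConnection (hκ : IsEquivariantLift G κ) (p : M)
    (u v : EuclideanSpace ℝ (Fin d)) :
    ((homConnection G hκ Λ).torsion p u v : EuclideanSpace ℝ (Fin d)) =
      Λ p u v - Λ p v u - orbitDeriv d G p (brE G (κ p u) (κ p v)) := by
  have h := (homConnection G hκ Λ).torsion_apply
    ((isSmoothField_orbitField (G := G) (M := M) (κ p u)).mdiffAt p)
    ((isSmoothField_orbitField (G := G) (M := M) (κ p v)).mdiffAt p)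
  have hu : orbitDeriv d G p (κ p u) = u := hκ.orbitDeriv_apply p u
  have hv : orbitDeriv d G p (κ p v) = v := hκ.orbitDeriv_apply p v
  have h1 : (homConnection G hκ Λ).torsion p (orbitDeriv d G p (κ p u)) (orbitDeriv d G p (κ p v)) =
      homDeriv G κ Λ (orbitField d G M (κ p v)) p (orbitDeriv d G p (κ p u))
      - homDeriv G κ Λ (orbitField d G M (κ p u)) p (orbitDeriv d G p (κ p v))
      - mlieBracketE (orbitField d G M (κ p u)) (orbitField d G M (κ p v)) p := h
  rw [hu, hv, homDeriv_orbitField, homDeriv_orbitField, hu, hv, mlieBracketE,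
    mlieBracket_orbitField, brE_swap (κ p u) (κ p v), map_neg] at h1
  refine h1.trans ?_
  abel

theorem isTorsionFree_homConnection_iff (hκ : IsEquivariantLift G κ) :
    IsTorsionFree (homConnection G hκ Λ) ↔ ∀ p u v,
      Λ p u v - Λ p v u - orbitDeriv d G p (brE G (κ p u) (κ p v)) = 0 := by
  refine ⟨fun h p u v => ?_, fun h => ?_⟩
  · rw [← torsion_homConnection hκ]
    have h1 : (homConnection G hκ Λ).torsion = 0 := h
    rw [h1]; rfl
  · funext p
    refine ContinuousLinearMap.ext fun u => ContinuousLinearMap.ext fun v => ?_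
    exact (torsion_homConnection hκ p u v).trans (h p u v)

variable {Ω : BilinField d M}

/-- The defect `v(Ω(Y, Z)) - Ω(∇_v Y, Z) - Ω(Y, ∇_v Z)` is tensorial in `Y`. -/
theorem tensorialAt_defect (hΩ : IsSymplecticForm Ω) (nabla : Connection d M) {Z : VField d M}
    (p : M) (hZ : MDifferentiableAt (𝓡 d) (𝓡 d).tangent
      (fun q => (⟨q, Z q⟩ : TangentBundle (𝓡 d) M)) p) (v : TangentSpace (𝓡 d) p) :
    TensorialAt (𝓡 d) (EuclideanSpace ℝ (Fin d)) (fun Y : VField d M =>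
      mvfderiv (𝓡 d) (fun q => Ω q (Y q) (Z q)) p v
        - Ω p (nabla Y p v) (Z p) - Ω p (Y p) (nabla Z p v)) p := by
  have hd : ∀ {Y : VField d M}, MDifferentiableAt (𝓡 d) (𝓡 d).tangent
      (fun q => (⟨q, Y q⟩ : TangentBundle (𝓡 d) M)) p →
      MDifferentiableAt (𝓡 d) 𝓘(ℝ, ℝ) (fun q => Ω q (Y q) (Z q)) p := by
    intro Y hY
    have h := MDifferentiableAt.clm_bundle_apply₂ (F₁ := EuclideanSpace ℝ (Fin d))
      (F₂ := EuclideanSpace ℝ (Fin d)) (F₃ := ℝ) (E₁ := (TangentSpace (𝓡 d) : M → Type _))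
      (E₂ := (TangentSpace (𝓡 d) : M → Type _)) (E₃ := Bundle.Trivial M ℝ)
      (b := fun q : M => q) (v := Y) (w := Z) ((hΩ.smooth p).mdifferentiableAt (by simp)) hY hZ
    exact (mdifferentiableAt_totalSpace (𝓡 d) _).1 h |>.2
  constructor
  · intro f Y hf hY
    have h1 := nabla.isCovariantDerivativeOnUniv.leibniz hY hf
    have h2 : (fun q => Ω q ((f • Y) q) (Z q)) = fun q => f q * Ω q (Y q) (Z q) := by
      funext q
      simp
    simp only [h1, h2, mvfderiv_fun_mul hf (hd hY)]
    simp
    ring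
  · intro Y Y' hY hY'
    have h1 := nabla.isCovariantDerivativeOnUniv.add hY hY'
    have h2 : (fun q => Ω q ((Y + Y') q) (Z q)) = fun q => Ω q (Y q) (Z q) + Ω q (Y' q) (Z q) := by
      funext q
      simp
    simp only [h1, h2, mvfderiv_fun_add (hd hY) (hd hY')]
    simp
    ring

/-- The connection preserves an invariant form exactly when every `Λ(u, ·)` is skew for it. The
defect is tensorial, so it suffices to compute it on fundamental fields, where the derivative of `Ω` and
the bracket terms of `∇` cancel. -/
theorem preservesForm_homConnection_iff (hΩ : IsSymplecticForm Ω)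
    (hinv : ∀ (g : G) (p : M) (u v : EuclideanSpace ℝ (Fin d)),
      formE Ω (g • p) (smulDeriv d g p u) (smulDeriv d g p v) = formE Ω p u v)
    (hκ : IsEquivariantLift G κ) :
    PreservesForm (homConnection G hκ Λ) Ω ↔ ∀ p u v w,
      formE Ω p (Λ p u v) w + formE Ω p v (Λ p u w) = 0 := by
  let Φ : M → EuclideanSpace ℝ (Fin d) → VField d M → VField d M → ℝ := fun p u Y Z =>
    tderiv (𝓡 d) 𝓘(ℝ, ℝ) (fun q => formE Ω q (Y q) (Z q)) p u
      - formE Ω p (homDeriv G κ Λ Y p u) (Z p) - formE Ω p (Y p) (homDeriv G κ Λ Z p u)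
  -- tensoriality in the second field follows from that in the first by antisymmetry
  have hanti : ∀ p u Y Z, Φ p u Y Z = -Φ p u Z Y := by
    intro p u Y Z
    have h1 : (fun q => formE Ω q (Y q) (Z q)) = fun q => -formE Ω q (Z q) (Y q) :=
      funext fun q => formE_swap hΩ q _ _
    have h2 : tderiv (𝓡 d) 𝓘(ℝ, ℝ) (fun q => -formE Ω q (Z q) (Y q)) p u =
        -tderiv (𝓡 d) 𝓘(ℝ, ℝ) (fun q => formE Ω q (Z q) (Y q)) p u :=
      congrArg (fun A : EuclideanSpace ℝ (Fin d) →L[ℝ] ℝ => A u) mfderiv_neg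
    have h3 := formE_swap hΩ p (homDeriv G κ Λ Y p u) (Z p)
    have h4 := formE_swap hΩ p (Y p) (homDeriv G κ Λ Z p u)
    simp only [Φ]
    rw [h1, h2]
    linarith
  have hpt : ∀ p u {Y Y' Z : VField d M}, IsSmoothField Y → IsSmoothField Y' → IsSmoothField Z →
      Y p = Y' p → Φ p u Y Z = Φ p u Y' Z := fun p u Y Y' Z hY hY' hZ h =>
    (tensorialAt_defect hΩ (homConnection G hκ Λ) p (hZ.mdiffAt p) u).pointwise
      (hY.mdiffAt p) (hY'.mdiffAt p) h
  have hfund : ∀ p u v w, Φ p u (orbitField d G M (κ p v)) (orbitField d G M (κ p w)) =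
      -(formE Ω p (Λ p u v) w + formE Ω p v (Λ p u w)) := by
    intro p u v w
    have h := tderiv_form_orbitField hΩ hinv (κ p u) (κ p v) (κ p w) p
    have hu := hκ.orbitDeriv_apply p u
    have hv := hκ.orbitDeriv_apply p v
    have hw := hκ.orbitDeriv_apply p w
    simp only [hu, hv, hw] at h
    have h1 := homDeriv_orbitField (G := G) (κ := κ) (Λ := Λ) (κ p v) p u
    have h2 := homDeriv_orbitField (G := G) (κ := κ) (Λ := Λ) (κ p w) p u
    have hv' : orbitField d G M (κ p v) p = v := hv
    have hw' : orbitField d G M (κ p w) p = w := hw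
    simp only [Φ]
    rw [h, h1, h2, hv', hw', hv, hw]
    simp only [map_add, map_neg, _root_.add_apply, _root_.neg_apply]
    ring
  constructor
  · intro h p u v w
    have h1 : Φ p u (orbitField d G M (κ p v)) (orbitField d G M (κ p w)) = 0 :=
      h _ _ (isSmoothField_orbitField _) (isSmoothField_orbitField _) p u
    rw [hfund] at h1
    linarith
  · intro h Y Z hY hZ p u
    change Φ p u Y Z = 0
    have hv := hκ.orbitDeriv_apply p (Y p)
    have hw := hκ.orbitDeriv_apply p (Z p)
    refine (hpt p u hY (isSmoothField_orbitField (κ p (Y p))) hZ hv.symm).trans ?_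
    refine (hanti p u _ _).trans (neg_eq_zero.2 ?_)
    refine (hpt p u hZ (isSmoothField_orbitField (κ p (Z p)))
      (isSmoothField_orbitField _) hw.symm).trans ?_
    exact (hfund p u _ _).trans (neg_eq_zero.2 (h p u _ _))

end Connection

/-! ### The product defined by a symplectic form -/

section LinearAlgebra

variable {E : Type*} [NormedAddCommGroup E] [NormedSpace ℝ E] [FiniteDimensional ℝ E]

/-- A trilinear form is represented by a bilinear product through a nondegenerate form. -/
theorem exists_product_of_nondegenerate (B : E →L[ℝ] E →L[ℝ] ℝ)
    (hB : ∀ v, (∀ w, B v w = 0) → v = 0) (T : E →L[ℝ] E →L[ℝ] E →L[ℝ] ℝ) :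
    ∃ Λ : E →L[ℝ] E →L[ℝ] E, ∀ v w u, B (Λ v w) u = T v w u := by
  have hinj : Function.Injective (B : E →ₗ[ℝ] E →L[ℝ] ℝ) :=
    (injective_iff_map_eq_zero _).2 fun v hv => hB v fun w =>
      congrArg (fun f : E →L[ℝ] ℝ => f w) hv
  have hdim : Module.finrank ℝ E = Module.finrank ℝ (E →L[ℝ] ℝ) :=
    (Subspace.dual_finrank_eq (K := ℝ) (V := E)).symm.trans
      (LinearMap.toContinuousLinearMap (𝕜 := ℝ) (E := E) (F' := ℝ)).finrank_eq
  let e := (LinearMap.linearEquivOfInjective (B : E →ₗ[ℝ] E →L[ℝ] ℝ) hinj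
    hdim).toContinuousLinearEquiv
  refine ⟨ContinuousLinearMap.compL ℝ E (E →L[ℝ] ℝ) E (e.symm : (E →L[ℝ] ℝ) →L[ℝ] E) ∘L T,
    fun v w u => ?_⟩
  exact congrArg (fun f : E →L[ℝ] ℝ => f u) (e.apply_symm_apply (T v w))

end LinearAlgebra

section Connection

variable {n d : ℕ} {G : Type*} [TopologicalSpace G] [ChartedSpace (EuclideanSpace ℝ (Fin n)) G]
  [Group G] [LieGroup (𝓡 n) ∞ G]
  {M : Type*} [TopologicalSpace M] [ChartedSpace (EuclideanSpace ℝ (Fin d)) M]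
  [MulAction G M] [IsManifold (𝓡 d) ∞ M] [hsm : ContMDiffSMul (𝓡 n) (𝓡 d) ∞ G M]
  {κ : M → EuclideanSpace ℝ (Fin d) →L[ℝ] EuclideanSpace ℝ (Fin n)}
  {Λ : M → EuclideanSpace ℝ (Fin d) →L[ℝ] EuclideanSpace ℝ (Fin d) →L[ℝ]
      EuclideanSpace ℝ (Fin d)}

variable (G) in
/-- The Lie bracket of the Lie algebra of `G` as a continuous bilinear map. -/
noncomputable def brL : EuclideanSpace ℝ (Fin n) →L[ℝ] EuclideanSpace ℝ (Fin n) →L[ℝ]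
    EuclideanSpace ℝ (Fin n) :=
  LinearMap.toContinuousLinearMap
    (LinearMap.toContinuousLinearMap.toLinearMap ∘ₗ LinearMap.mk₂ ℝ (brE G)
      (fun x y z => add_lie (L := GroupLieAlgebra (𝓡 n) G) (M := GroupLieAlgebra (𝓡 n) G) x y z)
      (fun c x y => smul_lie (R := ℝ) (L := GroupLieAlgebra (𝓡 n) G)
        (M := GroupLieAlgebra (𝓡 n) G) c x y)
      (fun x y z => lie_add (L := GroupLieAlgebra (𝓡 n) G) (M := GroupLieAlgebra (𝓡 n) G) x y z)
      (fun c x y => lie_smul (R := ℝ) (L := GroupLieAlgebra (𝓡 n) G)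
        (M := GroupLieAlgebra (𝓡 n) G) c x y))

variable (G) in
/-- The product on the tangent space at `p` given by the bracket of the lifts to the Lie algebra. -/
noncomputable def liftBracket
    (κ : M → EuclideanSpace ℝ (Fin d) →L[ℝ] EuclideanSpace ℝ (Fin n)) (p : M) :
    EuclideanSpace ℝ (Fin d) →L[ℝ] EuclideanSpace ℝ (Fin d) →L[ℝ] EuclideanSpace ℝ (Fin d) :=
  ContinuousLinearMap.compL ℝ _ _ _ (orbitDeriv d G p) ∘L (brL G).bilinearComp (κ p) (κ p)

theorem liftBracket_apply (p : M) (v w : EuclideanSpace ℝ (Fin d)) :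
    liftBracket G κ p v w = orbitDeriv d G p (brE G (κ p v) (κ p w)) := rfl

theorem liftBracket_swap (p : M) (v w : EuclideanSpace ℝ (Fin d)) :
    liftBracket G κ p w v = -liftBracket G κ p v w := by
  rw [liftBracket_apply, liftBracket_apply, brE_swap, map_neg]

/-- Translations are compatible with brackets in the Lie algebra. Only the fundamental fields are
compared, so that no use is made of `Ad g` being an automorphism. -/
theorem smulDeriv_orbitDeriv_brE (g : G) (p : M) (x y : EuclideanSpace ℝ (Fin n)) :
    smulDeriv d g p (orbitDeriv d G p (brE G x y)) =
      orbitDeriv d G (g • p) (brE G (AdE g x) (AdE g y)) := by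
  have h0 : ContMDiff (𝓡 d) (𝓡 d) 2 (fun q : M => g • q) :=
    (contMDiff_smul_left n g).of_le ENat.LEInfty.out
  have h1 := mfderiv_mlieBracket_of_related (I := 𝓡 d) (J := 𝓡 d) (f := fun q : M => g • q)
    (x := p) h0.contMDiffAt
    ((isSmoothField_orbitField (G := G) x).mdiffAt p)
    ((isSmoothField_orbitField (G := G) y).mdiffAt p)
    ((isSmoothField_orbitField (G := G) (AdE g x)).mdiffAt _)
    ((isSmoothField_orbitField (G := G) (AdE g y)).mdiffAt _)
    (Eventually.of_forall fun q => smulDeriv_orbitDeriv g q x)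
    (Eventually.of_forall fun q => smulDeriv_orbitDeriv g q y)
  have h2 := (congrArg (smulDeriv d g p) (mlieBracket_orbitField x y p)).symm.trans
    (h1.trans (mlieBracket_orbitField (AdE g x) (AdE g y) (g • p)))
  rw [map_neg] at h2
  exact neg_injective h2

theorem isEquivariantProduct_liftBracket (hκ : IsEquivariantLift G κ) :
    IsEquivariantProduct G (liftBracket G κ) := fun g p v w => by
  rw [liftBracket_apply, liftBracket_apply, hκ.smulDeriv_apply, hκ.smulDeriv_apply,
    smulDeriv_orbitDeriv_brE]

variable {Ω : BilinField d M}

variable (G) in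
/-- `Λ` is the family of products `L^{a,b}` on the tangent spaces:
`Ω(Λ(v, w), u) = a Ω([v, w], u) + b Ω([v, u], w)`, with `[v, w]` the bracket of the lifts. -/
def IsFormProduct (κ : M → EuclideanSpace ℝ (Fin d) →L[ℝ] EuclideanSpace ℝ (Fin n))
    (Ω : BilinField d M) (a b : ℝ)
    (Λ : M → EuclideanSpace ℝ (Fin d) →L[ℝ] EuclideanSpace ℝ (Fin d) →L[ℝ]
      EuclideanSpace ℝ (Fin d)) : Prop :=
  ∀ p v w u, formE Ω p (Λ p v w) u =
    a * formE Ω p (liftBracket G κ p v w) u + b * formE Ω p (liftBracket G κ p v u) w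

theorem formE_nondegenerate (hΩ : IsSymplecticForm Ω) (p : M) (v : EuclideanSpace ℝ (Fin d))
    (h : ∀ w : EuclideanSpace ℝ (Fin d), formE Ω p v w = 0) : v = 0 :=
  hΩ.nondegenerate p v h

theorem exists_isFormProduct (hΩ : IsSymplecticForm Ω) (a b : ℝ) :
    ∃ Λ, IsFormProduct G κ Ω a b Λ := by
  have h : ∀ p, ∃ L : EuclideanSpace ℝ (Fin d) →L[ℝ] EuclideanSpace ℝ (Fin d) →L[ℝ]
      EuclideanSpace ℝ (Fin d), ∀ v w u, formE Ω p (L v w) u =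
      a * formE Ω p (liftBracket G κ p v w) u + b * formE Ω p (liftBracket G κ p v u) w := by
    intro p
    let T₀ := ContinuousLinearMap.compL ℝ _ _ _ (formE Ω p) ∘L liftBracket G κ p
    obtain ⟨L, hL⟩ := exists_product_of_nondegenerate (formE Ω p) (formE_nondegenerate hΩ p)
      (a • T₀ + b • (ContinuousLinearMap.flipₗᵢ ℝ (EuclideanSpace ℝ (Fin d))
        (EuclideanSpace ℝ (Fin d)) ℝ).toContinuousLinearEquiv.toContinuousLinearMap ∘L T₀)
    exact ⟨L, fun v w u => (hL v w u).trans rfl⟩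
  choose Λ hΛ using h
  exact ⟨Λ, hΛ⟩

theorem IsFormProduct.isEquivariantProduct (hΩ : IsSymplecticForm Ω)
    (hinv : ∀ (g : G) (p : M) (u v : EuclideanSpace ℝ (Fin d)),
      formE Ω (g • p) (smulDeriv d g p u) (smulDeriv d g p v) = formE Ω p u v)
    (hκ : IsEquivariantLift G κ) {a b : ℝ} (hΛ : IsFormProduct G κ Ω a b Λ) :
    IsEquivariantProduct G Λ := by
  intro g p v w
  refine sub_eq_zero.1 (formE_nondegenerate hΩ (g • p) _ fun u => ?_)
  have hu := smulDeriv_apply_inv (d := d) n g p u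
  have h1 := hΛ (g • p) (smulDeriv d g p v) (smulDeriv d g p w) u
  have h2 := hΛ p v w (smulDeriv d g⁻¹ (g • p) u)
  have h3 := isEquivariantProduct_liftBracket hκ g p v
  rw [← hinv g p, ← hinv g p (liftBracket G κ p v w), ← hinv g p (liftBracket G κ p v _) w, h3, h3,
    hu, ← h1] at h2
  rw [map_sub, _root_.sub_apply, h2, sub_self]

variable {a b : ℝ}

/-- The cocycle identity: `dΩ = 0` at the point `p`, in terms of the bracket of lifts. -/
theorem liftBracket_cocycle (hΩ : IsSymplecticForm Ω)
    (hinv : ∀ (g : G) (p : M) (u v : EuclideanSpace ℝ (Fin d)),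
      formE Ω (g • p) (smulDeriv d g p u) (smulDeriv d g p v) = formE Ω p u v)
    (hκ : IsEquivariantLift G κ) (p : M) (u v w : EuclideanSpace ℝ (Fin d)) :
    formE Ω p (liftBracket G κ p u v) w - formE Ω p (liftBracket G κ p u w) v
      + formE Ω p (liftBracket G κ p v w) u = 0 := by
  have h := form_cocycle hΩ hinv (κ p u) (κ p v) (κ p w) p
  rwa [hκ.orbitDeriv_apply, hκ.orbitDeriv_apply, hκ.orbitDeriv_apply] at h

theorem preservesForm_iff (hΩ : IsSymplecticForm Ω)
    (hinv : ∀ (g : G) (p : M) (u v : EuclideanSpace ℝ (Fin d)),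
      formE Ω (g • p) (smulDeriv d g p u) (smulDeriv d g p v) = formE Ω p u v)
    (hκ : IsEquivariantLift G κ) (hΛ : IsFormProduct G κ Ω a b Λ)
    (hne : ∃ p v w, liftBracket G κ p v w ≠ 0) :
    PreservesForm (homConnection G hκ Λ) Ω ↔ a = b := by
  -- the cocycle identity turns the defect into a multiple of `Ω([v, w], u)`
  have key : ∀ p u v w, formE Ω p (Λ p u v) w + formE Ω p v (Λ p u w) =
      (b - a) * formE Ω p (liftBracket G κ p v w) u := by
    intro p u v w
    rw [formE_swap hΩ p v, hΛ, hΛ]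
    linear_combination (a - b) * liftBracket_cocycle hΩ hinv hκ p u v w
  rw [preservesForm_homConnection_iff hΩ hinv hκ]
  refine ⟨fun h => ?_, fun h p u v w => by rw [key, h, sub_self, zero_mul]⟩
  obtain ⟨p, v, w, hvw⟩ := hne
  by_contra hab
  refine hvw (formE_nondegenerate hΩ p _ fun u => ?_)
  have := h p u v w
  rw [key] at this
  exact (mul_eq_zero.1 this).resolve_left (sub_ne_zero.2 (Ne.symm hab))

theorem isTorsionFree_iff (hΩ : IsSymplecticForm Ω)
    (hinv : ∀ (g : G) (p : M) (u v : EuclideanSpace ℝ (Fin d)),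
      formE Ω (g • p) (smulDeriv d g p u) (smulDeriv d g p v) = formE Ω p u v)
    (hκ : IsEquivariantLift G κ) (hΛ : IsFormProduct G κ Ω a b Λ)
    (hne : ∃ p v w, liftBracket G κ p v w ≠ 0) :
    IsTorsionFree (homConnection G hκ Λ) ↔ a = (1 - b) / 2 := by
  -- the cocycle identity turns the torsion into a multiple of the bracket of lifts
  have key : ∀ p u v w, formE Ω p (Λ p u v - Λ p v u - liftBracket G κ p u v) w =
      (2 * a + b - 1) * formE Ω p (liftBracket G κ p u v) w := by
    intro p u v w
    simp only [map_sub, _root_.sub_apply, hΛ p _ _ _, liftBracket_swap p u v, map_neg,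
      _root_.neg_apply]
    linear_combination (-b) * liftBracket_cocycle hΩ hinv hκ p u v w
  rw [isTorsionFree_homConnection_iff hκ]
  refine ⟨fun h => ?_, fun h p u v => ?_⟩
  · obtain ⟨p, v, w, hvw⟩ := hne
    by_contra hab
    refine hvw (formE_nondegenerate hΩ p _ fun u => ?_)
    have h1 := key p v w u
    rw [liftBracket_apply, h p v w, map_zero] at h1
    refine (mul_eq_zero.1 h1.symm).resolve_left fun h2 => hab ?_
    linarith
  · refine formE_nondegenerate hΩ p _ fun w => (key p u v w).trans ?_
    rw [h]; ring

end Connection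

/-! ### Homogeneous spaces -/

section Submersion

variable {n d : ℕ} {M : Type*} [TopologicalSpace M] [ChartedSpace (EuclideanSpace ℝ (Fin n)) M]
  [IsManifold (𝓡 n) ∞ M]
  {N : Type*} [TopologicalSpace N] [ChartedSpace (EuclideanSpace ℝ (Fin d)) N]
  [IsManifold (𝓡 d) ∞ N]

/-- A submersion has smooth local sections through every point. -/
theorem exists_local_section {f : M → N} {x : M}
    (h : Manifold.IsSubmersionAt (𝓡 n) (𝓡 d) ∞ f x) :
    ∃ s : N → M, ContMDiffAt (𝓡 d) (𝓡 n) ∞ s (f x) ∧ s (f x) = x ∧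
      ∀ᶠ q in 𝓝 (f x), f (s q) = q := by
  let φ := h.domChart.extend (𝓡 n)
  let ψ := h.codChart.extend (𝓡 d)
  -- in the charts of a submersion `f` is a linear projection; the section keeps the vertical
  -- part `c`
  let c := (h.equiv (φ x)).2
  let u : N → EuclideanSpace ℝ (Fin n) := fun q => h.equiv.symm (ψ q, c)
  have hxφ : x ∈ h.domChart.source := h.mem_domChart_source
  have hxψ : f x ∈ h.codChart.source := h.mem_codChart_source
  have hφx : φ.symm (φ x) = x := h.domChart.extend_left_inv hxφ
  have hmem : φ x ∈ φ.target := φ.map_source (by rwa [h.domChart.extend_source])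
  have hw : ∀ y ∈ φ.target, ψ (f (φ.symm y)) = (h.equiv y).1 := fun y hy => h.writtenInCharts hy
  have hux : u (f x) = φ x := by
    have h1 := hw _ hmem
    rw [hφx] at h1
    change h.equiv.symm (ψ (f x), (h.equiv (φ x)).2) = φ x
    rw [h1]
    exact h.equiv.symm_apply_apply _
  have hψ : ContMDiffAt (𝓡 d) 𝓘(ℝ, EuclideanSpace ℝ (Fin d)) ∞ ψ (f x) :=
    h.codChart.contMDiffAt_extend h.codChart_mem_maximalAtlas hxψ
  have hu : ContMDiffAt (𝓡 d) 𝓘(ℝ, EuclideanSpace ℝ (Fin n)) ∞ u (f x) :=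
    h.equiv.symm.contDiff.contMDiff.contMDiffAt.comp (f x) (hψ.prodMk_space contMDiffAt_const)
  have hopen : IsOpen φ.target := h.domChart.isOpen_extend_target
  have hφs : ContMDiffAt 𝓘(ℝ, EuclideanSpace ℝ (Fin n)) (𝓡 n) ∞ φ.symm (u (f x)) := by
    rw [hux]
    refine (contMDiffOn_extend_symm h.domChart_mem_maximalAtlas).contMDiffAt
      (mem_of_superset (hopen.mem_nhds hmem) ?_)
    exact h.domChart.extend_target'.le
  refine ⟨fun q => φ.symm (u q), hφs.comp (f x) hu, (congrArg φ.symm hux).trans hφx, ?_⟩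
  have hev : ∀ᶠ q in 𝓝 (f x), u q ∈ φ.target :=
    hu.continuousAt.eventually_mem (hopen.mem_nhds (by rwa [hux]))
  filter_upwards [hev, h.codChart.open_source.mem_nhds hxψ] with q hq hq'
  have h1 := hw _ hq
  have h2 : (h.equiv (u q)).1 = ψ q := congrArg Prod.fst (h.equiv.apply_symm_apply (ψ q, c))
  rw [h2] at h1
  have h3 : φ.symm (u q) ∈ h.domChart.source := by
    have := φ.map_target hq
    rwa [h.domChart.extend_source] at this
  refine ψ.injOn ?_ ?_ h1
  · rw [h.codChart.extend_source]; exact h.source_subset_preimage_source h3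
  · rwa [h.codChart.extend_source]

/-- Every tangent vector is the velocity of a smooth curve. -/
theorem exists_curve (x : M) (v : EuclideanSpace ℝ (Fin n)) :
    ∃ c : ℝ → M, ContMDiffAt 𝓘(ℝ, ℝ) (𝓡 n) ∞ c 0 ∧ c 0 = x ∧
      tderiv 𝓘(ℝ, ℝ) (𝓡 n) c 0 (1 : ℝ) = v := by
  let φ := extChartAt (𝓡 n) x
  have hmem : φ x ∈ φ.target := mem_extChartAt_target x
  have hinv := isInvertible_mfderivWithin_extChartAt_symm (I := 𝓡 n) hmem
  rw [ModelWithCorners.range_eq_univ, mfderivWithin_univ] at hinv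
  obtain ⟨w, hw⟩ : ∃ w : EuclideanSpace ℝ (Fin n),
      tderiv 𝓘(ℝ, EuclideanSpace ℝ (Fin n)) (𝓡 n) φ.symm (φ x) w = v := hinv.surjective v
  let l : ℝ → EuclideanSpace ℝ (Fin n) := fun t => φ x + t • w
  have hl : ContDiff ℝ ∞ l := contDiff_const.add (contDiff_id.smul contDiff_const)
  have hl0 : l 0 = φ x := by simp [l]
  have hφs : ContMDiffAt 𝓘(ℝ, EuclideanSpace ℝ (Fin n)) (𝓡 n) ∞ φ.symm (l 0) := by
    rw [hl0]
    exact (contMDiffOn_extChartAt_symm x).contMDiffAt (extChartAt_target_mem_nhds x)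
  refine ⟨fun t => φ.symm (l t), hφs.comp (0 : ℝ) hl.contMDiff.contMDiffAt,
    (congrArg φ.symm hl0).trans (extChartAt_to_inv x), ?_⟩
  have h1 := tderiv_comp (I := 𝓘(ℝ, ℝ)) (f := l) (0 : ℝ) (hφs.mdifferentiableAt (by simp))
    (hl.contMDiff.contMDiffAt.mdifferentiableAt (by simp)) (1 : ℝ)
  have h2 : tderiv 𝓘(ℝ, ℝ) 𝓘(ℝ, EuclideanSpace ℝ (Fin n)) l 0 (1 : ℝ) = w := by
    have h3 : HasDerivAt l w 0 := by
      have h4 := ((hasDerivAt_id (0 : ℝ)).smul_const w).const_add (φ x)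
      rwa [one_smul] at h4
    rw [tderiv, mfderiv_eq_fderiv]
    refine (congrArg (fun A : ℝ →L[ℝ] EuclideanSpace ℝ (Fin n) => A 1)
      h3.hasFDerivAt.fderiv).trans ?_
    simp
  rw [h2, hl0] at h1
  exact h1.trans hw

end Submersion

section Homogeneous

variable {n d : ℕ} {G : Type*} [TopologicalSpace G] [ChartedSpace (EuclideanSpace ℝ (Fin n)) G]
  [Group G] [LieGroup (𝓡 n) ∞ G] {H : Subgroup G}
  [ChartedSpace (EuclideanSpace ℝ (Fin d)) (G ⧸ H)] [IsManifold (𝓡 d) ∞ (G ⧸ H)]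

/-- The action of `G` on `G ⧸ H` is smooth when the projection is a submersion. -/
theorem contMDiffSMul_quotient
    (hπ : Manifold.IsSubmersion (𝓡 n) (𝓡 d) ∞ (fun g : G => (g : G ⧸ H))) :
    ContMDiffSMul (𝓡 n) (𝓡 d) ∞ G (G ⧸ H) := by
  refine ⟨fun ⟨g, q⟩ => ?_⟩
  obtain ⟨k, rfl⟩ := QuotientGroup.mk_surjective q
  obtain ⟨s, hs, hsk, hsq⟩ := exists_local_section (hπ.isSubmersionAt k)
  have h1 : ContMDiffAt ((𝓡 n).prod (𝓡 d)) (𝓡 d) ∞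
      (fun p : G × G ⧸ H => ((p.1 * s p.2 : G) : G ⧸ H)) (g, (k : G ⧸ H)) :=
    (hπ.contMDiff.contMDiffAt).comp (g, (k : G ⧸ H))
      (contMDiffAt_fst.mul (ContMDiffAt.comp (g, (k : G ⧸ H)) hs contMDiffAt_snd))
  refine h1.congr_of_eventuallyEq ?_
  filter_upwards [continuousAt_snd.eventually hsq] with p hp
  exact congrArg (fun q : G ⧸ H => p.1 • q) hp.symm

/-- A local section `s` of the projection near `k`, corrected to `q ↦ s q * k⁻¹`, translates the
coset of `k` to `q`. -/
theorem hasLocalSections_quotient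
    (hπ : Manifold.IsSubmersion (𝓡 n) (𝓡 d) ∞ (fun g : G => (g : G ⧸ H))) :
    HasLocalSections n d G (G ⧸ H) := by
  intro p
  obtain ⟨k, rfl⟩ := QuotientGroup.mk_surjective p
  obtain ⟨s, hs, hsk, hsq⟩ := exists_local_section (hπ.isSubmersionAt k)
  refine ⟨fun q => s q * k⁻¹, hs.mul contMDiffAt_const, by simp [hsk], ?_⟩
  filter_upwards [hsq] with q hq
  refine Eq.trans (congrArg (fun g : G => (g : G ⧸ H)) ?_) hq
  simp

theorem orbitDeriv_one_eq :
    orbitDeriv d G ((1 : G) : G ⧸ H) = tderiv (𝓡 n) (𝓡 d) (fun g : G => (g : G ⧸ H)) 1 := by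
  rw [orbitDeriv]
  refine congrArg (fun f : G → G ⧸ H => tderiv (𝓡 n) (𝓡 d) f 1) (funext fun g => ?_)
  exact congrArg (fun g : G => (g : G ⧸ H)) (mul_one g)

/-- The fundamental field of `x` vanishes at the origin exactly when `x` is in the Lie algebra of
the isotropy group `H`. -/
theorem orbitDeriv_eq_zero_iff
    (hπ : Manifold.IsSubmersion (𝓡 n) (𝓡 d) ∞ (fun g : G => (g : G ⧸ H)))
    (x : GroupLieAlgebra (𝓡 n) G) :
    orbitDeriv d G ((1 : G) : G ⧸ H) x = 0 ↔ x ∈ lieAlgebraOf H := by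
  rw [orbitDeriv_one_eq]
  have hd : ∀ g : G, MDifferentiableAt (𝓡 n) (𝓡 d) (fun g : G => (g : G ⧸ H)) g :=
    hπ.contMDiff.mdifferentiable (by simp)
  constructor
  · intro hx
    refine (isVelocityIn_iff H x).2 ?_
    obtain ⟨γ, hγ, hγ0, hγ1⟩ := exists_curve (1 : G) x
    obtain ⟨s, hs, hs1, hsq⟩ := exists_local_section (hπ.isSubmersionAt 1)
    have hπγ : ContMDiffAt 𝓘(ℝ, ℝ) (𝓡 d) ∞ (fun t => (γ t : G ⧸ H)) 0 :=
      hπ.contMDiff.contMDiffAt.comp (0 : ℝ) hγ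
    have hs' : ContMDiffAt (𝓡 d) (𝓡 n) ∞ s (γ 0 : G ⧸ H) := by rwa [hγ0]
    have hsγ : ContMDiffAt 𝓘(ℝ, ℝ) (𝓡 n) ∞ (fun t => s (γ t : G ⧸ H)) 0 :=
      ContMDiffAt.comp (0 : ℝ) hs' hπγ
    -- dividing the curve by the section moves it into `H`
    let c : ℝ → G := fun t => (s (γ t : G ⧸ H))⁻¹ * γ t
    have hc : ContMDiffAt 𝓘(ℝ, ℝ) (𝓡 n) ∞ c 0 := hsγ.inv.mul hγ
    have hc0 : c 0 = 1 := by simp [c, hγ0, hs1]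
    refine ⟨c, hc, ?_, hc0, ?_⟩
    · have hlim : Tendsto (fun t => (γ t : G ⧸ H)) (𝓝 0) (𝓝 ((1 : G) : G ⧸ H)) := by
        have := hπγ.continuousAt.tendsto
        rwa [hγ0] at this
      filter_upwards [hlim.eventually hsq] with t ht
      exact QuotientGroup.eq.1 ht
    · have h1 : tderiv 𝓘(ℝ, ℝ) (𝓡 n) (fun t => s (γ t : G ⧸ H)) 0 (1 : ℝ) = 0 := by
        refine (tderiv_comp (I := 𝓘(ℝ, ℝ)) (J := 𝓡 d) (0 : ℝ) (hs'.mdifferentiableAt (by simp))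
          (hπγ.mdifferentiableAt (by simp)) (1 : ℝ)).trans ?_
        have h2 := tderiv_comp (I := 𝓘(ℝ, ℝ)) (J := 𝓡 n) (L := 𝓡 d) (f := γ)
          (g := fun g : G => (g : G ⧸ H)) (0 : ℝ) (hd _) (hγ.mdifferentiableAt (by simp)) (1 : ℝ)
        rw [hγ1, hγ0] at h2
        rw [h2, hx, map_zero]
      have h3 := tderiv_comp₂ (f := fun p : G × G => p.1 * p.2) (a := fun t => s (γ t : G ⧸ H))
        (b := c) (0 : ℝ) ((contMDiff_mul (𝓡 n) ∞).contMDiffAt.mdifferentiableAt (by simp))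
        (hsγ.mdifferentiableAt (by simp)) (hc.mdifferentiableAt (by simp)) (1 : ℝ)
      have h4 : (fun t => s (γ t : G ⧸ H) * c t) = γ := funext fun t => mul_inv_cancel_left _ _
      have h5 : (fun g : G => s (γ 0 : G ⧸ H) * g) = fun g => g := by
        rw [hγ0, hs1]; exact funext one_mul
      rw [h1, map_zero, zero_add] at h3
      simp only [h4, h5] at h3
      rw [hγ1, tderiv_id] at h3
      exact h3.symm
  · intro hx
    obtain ⟨c, hc, hcH, hc0, hcx⟩ := (isVelocityIn_iff H x).1 hx
    have h1 := tderiv_comp (I := 𝓘(ℝ, ℝ)) (J := 𝓡 n) (L := 𝓡 d) (f := c)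
      (g := fun g : G => (g : G ⧸ H)) (0 : ℝ) (hd _) (hc.mdifferentiableAt (by simp)) (1 : ℝ)
    have h2 : (fun t => (c t : G ⧸ H)) =ᶠ[𝓝 0] fun _ => ((1 : G) : G ⧸ H) := by
      filter_upwards [hcH] with t ht
      exact QuotientGroup.eq.2 (by simpa using ht)
    rw [tderiv_congr h2, tderiv_const, hc0] at h1
    exact (h1.trans (congrArg _ hcx)).symm

/-- The fundamental fields of `x` and of its projection `x_𝔪` agree at the origin. -/
theorem orbitDeriv_mProj
    (hπ : Manifold.IsSubmersion (𝓡 n) (𝓡 d) ∞ (fun g : G => (g : G ⧸ H)))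
    {𝔪 : Submodule ℝ (GroupLieAlgebra (𝓡 n) G)} (hr : IsReductive H 𝔪)
    (x : GroupLieAlgebra (𝓡 n) G) :
    orbitDeriv d G ((1 : G) : G ⧸ H) (mProj hr x : GroupLieAlgebra (𝓡 n) G) =
      orbitDeriv d G ((1 : G) : G ⧸ H) x := by
  have h1 := (orbitDeriv_eq_zero_iff hπ (x - (mProj hr x : GroupLieAlgebra (𝓡 n) G))).2 (by
    refine (Submodule.projectionOnto_apply_eq_zero_iff hr.isCompl.symm).1 ?_
    rw [map_sub]
    exact sub_eq_zero.2 (Submodule.projectionOnto_apply_left hr.isCompl.symm _).symm)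
  exact (sub_eq_zero.1 ((map_sub (orbitDeriv d G ((1 : G) : G ⧸ H)) x _).symm.trans h1)).symm

/-- The projection `G → G ⧸ H` identifies the complement `𝔪` with the tangent space at the
origin; this is the inverse identification. -/
theorem exists_lift_at_one
    (hπ : Manifold.IsSubmersion (𝓡 n) (𝓡 d) ∞ (fun g : G => (g : G ⧸ H)))
    {𝔪 : Submodule ℝ (GroupLieAlgebra (𝓡 n) G)} (hr : IsReductive H 𝔪) :
    ∃ κ₀ : EuclideanSpace ℝ (Fin d) →L[ℝ] EuclideanSpace ℝ (Fin n),
      (∀ v, κ₀ v ∈ 𝔪) ∧ (∀ v, orbitDeriv d G ((1 : G) : G ⧸ H) (κ₀ v) = v) ∧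
      ∀ x ∈ 𝔪, κ₀ (orbitDeriv d G ((1 : G) : G ⧸ H) x) = x := by
  obtain ⟨s, hs, hs1, hsq⟩ := exists_local_section (hπ.isSubmersionAt 1)
  have hinj : ∀ x ∈ 𝔪, ∀ y ∈ 𝔪, orbitDeriv d G ((1 : G) : G ⧸ H) x =
      orbitDeriv d G ((1 : G) : G ⧸ H) y → x = y := by
    intro x hx y hy hxy
    have h1 : x - y ∈ lieAlgebraOf H := (orbitDeriv_eq_zero_iff hπ _).1
      ((map_sub (orbitDeriv d G ((1 : G) : G ⧸ H)) x y).trans (sub_eq_zero.2 hxy))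
    have h2 : x - y ∈ lieAlgebraOf H ⊓ 𝔪 := ⟨h1, 𝔪.sub_mem hx hy⟩
    rw [hr.isCompl.inf_eq_bot] at h2
    exact sub_eq_zero.1 ((Submodule.mem_bot ℝ).1 h2)
  let D : EuclideanSpace ℝ (Fin d) →ₗ[ℝ] GroupLieAlgebra (𝓡 n) G :=
    (tderiv (𝓡 d) (𝓡 n) s ((1 : G) : G ⧸ H)).toLinearMap
  let κ₀ : EuclideanSpace ℝ (Fin d) →ₗ[ℝ] EuclideanSpace ℝ (Fin n) :=
    𝔪.subtype ∘ₗ mProj hr ∘ₗ D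
  have hright : ∀ v, orbitDeriv d G ((1 : G) : G ⧸ H) (κ₀ v) = v := by
    intro v
    refine (orbitDeriv_mProj hπ hr (D v)).trans ?_
    rw [orbitDeriv_one_eq]
    have h1 := tderiv_comp (I := 𝓡 d) (J := 𝓡 n) (L := 𝓡 d) (f := s)
      (g := fun g : G => (g : G ⧸ H)) ((1 : G) : G ⧸ H)
      (hπ.contMDiff.mdifferentiable (by simp) _) (hs.mdifferentiableAt (by simp)) v
    rw [tderiv_congr hsq, tderiv_id, hs1] at h1
    exact h1.symm
  exact ⟨LinearMap.toContinuousLinearMap κ₀, fun v => (mProj hr (D v)).2, hright,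
    fun x hx => hinj _ (mProj hr _).2 x hx (hright _)⟩

/-- A reductive decomposition induces an equivariant lift of tangent vectors of `G ⧸ H` to the Lie
algebra, which at the origin takes its values in `𝔪`. -/
theorem exists_isEquivariantLift
    (hπ : Manifold.IsSubmersion (𝓡 n) (𝓡 d) ∞ (fun g : G => (g : G ⧸ H)))
    {𝔪 : Submodule ℝ (GroupLieAlgebra (𝓡 n) G)} (hr : IsReductive H 𝔪) :
    ∃ κ : G ⧸ H → EuclideanSpace ℝ (Fin d) →L[ℝ] EuclideanSpace ℝ (Fin n),
      IsEquivariantLift G κ ∧ (∀ v, κ ((1 : G) : G ⧸ H) v ∈ 𝔪) ∧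
      ∀ x ∈ 𝔪, κ ((1 : G) : G ⧸ H) (orbitDeriv d G ((1 : G) : G ⧸ H) x) = x := by
  have := contMDiffSMul_quotient hπ
  obtain ⟨κ₀, hmem, hright, hleft⟩ := exists_lift_at_one hπ hr
  set o : G ⧸ H := ((1 : G) : G ⧸ H) with ho
  have hsmul : ∀ g : G, g • o = (g : G ⧸ H) := fun g =>
    congrArg (fun g : G => (g : G ⧸ H)) (mul_one g)
  -- the identification at the origin is equivariant under the isotropy group, as `Ad(H)𝔪 = 𝔪`
  have hH : ∀ h ∈ H, ∀ v, κ₀ (smulDeriv d h o v) = AdE h (κ₀ v) := by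
    intro h hh v
    have hho : h • o = o := by
      rw [hsmul, ho]; exact QuotientGroup.eq.2 (by simpa using hh)
    have h1 := smulDeriv_orbitDeriv (d := d) h o (κ₀ v)
    rw [hright, hho] at h1
    rw [h1]
    refine hleft _ ?_
    rw [← hr.map_Ad h hh]
    exact Submodule.mem_map_of_mem (f := Ad h) (hmem v)
  -- transport `κ₀` along a representative of the coset `p`; by `hH` the choice does not matter
  let κ : G ⧸ H → EuclideanSpace ℝ (Fin d) →L[ℝ] EuclideanSpace ℝ (Fin n) := fun p =>
    AdE p.out ∘L κ₀ ∘L smulDeriv d p.out⁻¹ p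
  have hκ : ∀ (g : G) v, κ (g • o) (smulDeriv d g o v) = AdE g (κ₀ v) := by
    intro g v
    set k : G := (g • o).out with hk
    have hkH : k⁻¹ * g ∈ H := by
      refine QuotientGroup.eq.1 ?_
      rw [hk, hsmul]
      exact QuotientGroup.out_eq' _
    change AdE k (κ₀ (smulDeriv d k⁻¹ (g • o) (smulDeriv d g o v))) = _
    rw [← smulDeriv_mul n, hH _ hkH, ← AdE_mul, mul_inv_cancel_left]
  have hκo : ∀ v, κ o v = κ₀ v := by
    intro v
    have h1 := hκ 1 v
    rwa [smulDeriv_one, one_smul, AdE_one] at h1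
  refine ⟨κ, ⟨fun p v => ?_, fun k p v => ?_⟩, fun v => ?_, fun x hx => ?_⟩
  · obtain ⟨g, rfl⟩ : ∃ g : G, g • o = p :=
      (QuotientGroup.mk_surjective p).imp fun g hg => (hsmul g).trans hg
    have h1 := hκ g (smulDeriv d g⁻¹ (g • o) v)
    rw [smulDeriv_apply_inv n] at h1
    rw [h1, ← smulDeriv_orbitDeriv, hright, smulDeriv_apply_inv n]
  · obtain ⟨g, rfl⟩ : ∃ g : G, g • o = p :=
      (QuotientGroup.mk_surjective p).imp fun g hg => (hsmul g).trans hg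
    have h1 := hκ g (smulDeriv d g⁻¹ (g • o) v)
    have h2 := hκ (k * g) (smulDeriv d g⁻¹ (g • o) v)
    rw [smulDeriv_mul n, smulDeriv_apply_inv n, mul_smul, AdE_mul, ← h1,
      smulDeriv_apply_inv n] at h2
    exact h2
  · rw [hκo]; exact hmem v
  · rw [hκo]; exact hleft x hx

end Homogeneous

/-! ### The associated product on the reductive complement -/

section Final

variable {n d : ℕ} {G : Type*} [TopologicalSpace G] [ChartedSpace (EuclideanSpace ℝ (Fin n)) G]
  [Group G] [LieGroup (𝓡 n) ∞ G] {H : Subgroup G}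
  [ChartedSpace (EuclideanSpace ℝ (Fin d)) (G ⧸ H)] [IsManifold (𝓡 d) ∞ (G ⧸ H)]
  {𝔪 : Submodule ℝ (GroupLieAlgebra (𝓡 n) G)}
  {κ : G ⧸ H → EuclideanSpace ℝ (Fin d) →L[ℝ] EuclideanSpace ℝ (Fin n)}
  {Ω : BilinField d (G ⧸ H)}

theorem projDeriv_eq_orbitDeriv (x : GroupLieAlgebra (𝓡 n) G) :
    projDeriv d H x = orbitDeriv d G ((1 : G) : G ⧸ H) x := by
  rw [orbitDeriv_one_eq]; rfl

theorem inducedTensor_apply (x y : 𝔪) : inducedTensor Ω 𝔪 x y =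
    formE Ω ((1 : G) : G ⧸ H) (orbitDeriv d G ((1 : G) : G ⧸ H) (x : GroupLieAlgebra (𝓡 n) G))
      (orbitDeriv d G ((1 : G) : G ⧸ H) (y : GroupLieAlgebra (𝓡 n) G)) := by
  rw [orbitDeriv_one_eq]; rfl

/-- The form induced on `𝔪` by an invariant symplectic form is nondegenerate. -/
theorem inducedTensor_nondegenerate (hΩ : IsSymplecticForm Ω) (hκ : IsEquivariantLift G κ)
    (hκm : ∀ v, κ ((1 : G) : G ⧸ H) v ∈ 𝔪)
    (hκl : ∀ x ∈ 𝔪, κ ((1 : G) : G ⧸ H) (orbitDeriv d G ((1 : G) : G ⧸ H) x) = x) :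
    (inducedTensor Ω 𝔪).Nondegenerate := by
  have h : ∀ x : 𝔪, (∀ y : 𝔪, inducedTensor Ω 𝔪 x y = 0) → x = 0 := by
    intro x hx
    have h1 : orbitDeriv d G ((1 : G) : G ⧸ H) (x : GroupLieAlgebra (𝓡 n) G) = 0 := by
      refine formE_nondegenerate hΩ ((1 : G) : G ⧸ H) _ fun w => ?_
      have h2 := hx ⟨κ ((1 : G) : G ⧸ H) w, hκm w⟩
      rw [inducedTensor_apply] at h2
      have h3 := hκ.orbitDeriv_apply ((1 : G) : G ⧸ H) w
      exact (congrArg _ h3).symm.trans h2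
    have h2 := hκl x x.2
    rw [h1, map_zero] at h2
    exact Subtype.ext h2.symm
  refine ⟨h, fun y hy => h y fun x => ?_⟩
  rw [inducedTensor_apply, formE_swap hΩ, ← inducedTensor_apply, hy, neg_zero]

/-- The connection given by the lift with values in `𝔪` and a product `Λ` on the tangent spaces is
associated with the product that `Λ` induces on `𝔪`. -/
theorem nomizuProduct_homConnection [ContMDiffSMul (𝓡 n) (𝓡 d) ∞ G (G ⧸ H)]
    {Λ : G ⧸ H → EuclideanSpace ℝ (Fin d) →L[ℝ] EuclideanSpace ℝ (Fin d) →L[ℝ]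
      EuclideanSpace ℝ (Fin d)} (hκ : IsEquivariantLift G κ)
    (hκl : ∀ x ∈ 𝔪, κ ((1 : G) : G ⧸ H) (orbitDeriv d G ((1 : G) : G ⧸ H) x) = x) (x y : 𝔪) :
    (nomizuProduct (n := n) (homConnection G hκ Λ) x y : EuclideanSpace ℝ (Fin d)) =
      Λ ((1 : G) : G ⧸ H) (orbitDeriv d G ((1 : G) : G ⧸ H) (x : GroupLieAlgebra (𝓡 n) G))
        (orbitDeriv d G ((1 : G) : G ⧸ H) (y : GroupLieAlgebra (𝓡 n) G)) := by
  have h : (nomizuProduct (n := n) (homConnection G hκ Λ) x y : EuclideanSpace ℝ (Fin d)) =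
      homDeriv G κ Λ (orbitField d G (G ⧸ H) (y : GroupLieAlgebra (𝓡 n) G)) ((1 : G) : G ⧸ H)
        (orbitDeriv d G ((1 : G) : G ⧸ H) (x : GroupLieAlgebra (𝓡 n) G))
      - mlieBracketE (orbitField d G (G ⧸ H) (x : GroupLieAlgebra (𝓡 n) G))
        (orbitField d G (G ⧸ H) (y : GroupLieAlgebra (𝓡 n) G)) ((1 : G) : G ⧸ H) := rfl
  rw [h, homDeriv_apply, hκl x x.2]
  exact add_sub_cancel_left _ _

/-- At the origin the bracket of lifts is the bracket `[x, y]_𝔪`: the component in the Lie algebra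
of `H` does not contribute to the fundamental field. -/
theorem liftBracket_one [ContMDiffSMul (𝓡 n) (𝓡 d) ∞ G (G ⧸ H)] (hr : IsReductive H 𝔪)
    (hπ : Manifold.IsSubmersion (𝓡 n) (𝓡 d) ∞ (fun g : G => (g : G ⧸ H)))
    (hκl : ∀ x ∈ 𝔪, κ ((1 : G) : G ⧸ H) (orbitDeriv d G ((1 : G) : G ⧸ H) x) = x) (x y : 𝔪) :
    liftBracket G κ ((1 : G) : G ⧸ H)
      (orbitDeriv d G ((1 : G) : G ⧸ H) (x : GroupLieAlgebra (𝓡 n) G))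
      (orbitDeriv d G ((1 : G) : G ⧸ H) (y : GroupLieAlgebra (𝓡 n) G)) =
    orbitDeriv d G ((1 : G) : G ⧸ H) (bracketM hr x y : GroupLieAlgebra (𝓡 n) G) := by
  rw [liftBracket_apply, hκl x x.2, hκl y y.2, bracketM_apply, orbitDeriv_mProj hπ hr]
  rfl

/-- The connection of the products `L^{a,b}` on the tangent spaces is associated with the product
`L^{a,b}` on `𝔪`. -/
theorem hasProduct_homConnection [ContMDiffSMul (𝓡 n) (𝓡 d) ∞ G (G ⧸ H)]
    {Λ : G ⧸ H → EuclideanSpace ℝ (Fin d) →L[ℝ] EuclideanSpace ℝ (Fin d) →L[ℝ]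
      EuclideanSpace ℝ (Fin d)} (hr : IsReductive H 𝔪)
    (hπ : Manifold.IsSubmersion (𝓡 n) (𝓡 d) ∞ (fun g : G => (g : G ⧸ H)))
    (hΩ : IsSymplecticForm Ω) (hω : (inducedTensor Ω 𝔪).Nondegenerate)
    (hκ : IsEquivariantLift G κ) (hκm : ∀ v, κ ((1 : G) : G ⧸ H) v ∈ 𝔪)
    (hκl : ∀ x ∈ 𝔪, κ ((1 : G) : G ⧸ H) (orbitDeriv d G ((1 : G) : G ⧸ H) x) = x)
    {a b : ℝ} (hΛ : IsFormProduct G κ Ω a b Λ) :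
    HasProduct (homConnection G hκ Λ) 𝔪 (productL hr (inducedTensor Ω 𝔪) hω a b) := by
  intro x y
  refine (nomizuProduct_homConnection hκ hκl x y).trans ?_
  refine Eq.trans ?_ (projDeriv_eq_orbitDeriv _).symm
  have key : ∀ A B : EuclideanSpace ℝ (Fin d),
      (∀ u, formE Ω ((1 : G) : G ⧸ H) A u = formE Ω ((1 : G) : G ⧸ H) B u) → A = B := by
    refine fun A B h => sub_eq_zero.1 (formE_nondegenerate hΩ ((1 : G) : G ⧸ H) _ fun u => ?_)
    rw [map_sub, _root_.sub_apply, h, sub_self]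
  refine key _ _ fun u => ?_
  have h1 := productL_spec hr _ hω a b x y ⟨κ ((1 : G) : G ⧸ H) u, hκm u⟩
  have h2 := liftBracket_one hr hπ hκl x ⟨κ ((1 : G) : G ⧸ H) u, hκm u⟩
  have h3 := liftBracket_one hr hπ hκl x y
  have h4 : orbitDeriv d G ((1 : G) : G ⧸ H) (κ ((1 : G) : G ⧸ H) u) = u :=
    hκ.orbitDeriv_apply _ u
  simp only [inducedTensor_apply] at h1
  rw [← h2, ← h3] at h1
  simp only [h4] at h1
  exact (hΛ _ _ _ _).trans h1.symm

end Final

end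

theorem theorem1 {n d : ℕ} {G : Type*} [TopologicalSpace G]
    [ChartedSpace (EuclideanSpace ℝ (Fin n)) G] [Group G] [LieGroup (𝓡 n) ∞ G]
    (H : Subgroup G) (hH : IsClosed (H : Set G))
    [ChartedSpace (EuclideanSpace ℝ (Fin d)) (G ⧸ H)] [IsManifold (𝓡 d) ∞ (G ⧸ H)]
    (hπ : Manifold.IsSubmersion (𝓡 n) (𝓡 d) ∞ (fun g : G => (g : G ⧸ H)))
    (Ω : BilinField d (G ⧸ H)) (hΩ : IsSymplecticForm Ω) (hinv : IsInvariantForm Ω)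
    (𝔪 : Submodule ℝ (GroupLieAlgebra (𝓡 n) G)) (hr : IsReductive H 𝔪)
    (hns : ¬ IsLocallySymmetric H 𝔪) :
    ∃ hω : (inducedTensor Ω 𝔪).Nondegenerate, ∀ a b : ℝ,
      ∃ nabla : Connection d (G ⧸ H),
        (CovariantDerivative.ContMDiffCovariantDerivative nabla ∞ ∧
          IsInvariantConnection nabla ∧
          HasProduct nabla 𝔪 (productL hr (inducedTensor Ω 𝔪) hω a b)) ∧
        (∀ nabla' : Connection d (G ⧸ H), IsInvariantConnection nabla' →
          HasProduct nabla' 𝔪 (productL hr (inducedTensor Ω 𝔪) hω a b) →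
          ∀ Y : VField d (G ⧸ H), IsSmoothField Y → nabla' Y = nabla Y) ∧
        (PreservesForm nabla Ω ↔ a = b) ∧
        (IsTorsionFree nabla ↔ a = (1 - b) / 2) ∧
        (IsSymplecticConnection nabla Ω ↔ a = 1 / 3 ∧ b = 1 / 3) := by
  have := contMDiffSMul_quotient hπ
  obtain ⟨κ, hκ, hκm, hκl⟩ := exists_isEquivariantLift hπ hr
  have hω := inducedTensor_nondegenerate hΩ hκ hκm hκl
  have hinv' : ∀ (g : G) (p : G ⧸ H) (u v : EuclideanSpace ℝ (Fin d)),
      formE Ω (g • p) (smulDeriv d g p u) (smulDeriv d g p v) = formE Ω p u v := hinv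
  -- if the bracket of lifts vanished at the origin, `[𝔪, 𝔪]` would lie in the Lie algebra of `H`
  have hne : ∃ p v w, liftBracket G κ p v w ≠ 0 := by
    by_contra! h0
    refine hns fun x hx y hy => (orbitDeriv_eq_zero_iff (d := d) hπ _).1 ?_
    have h1 := h0 ((1 : G) : G ⧸ H) (orbitDeriv d G ((1 : G) : G ⧸ H) x)
      (orbitDeriv d G ((1 : G) : G ⧸ H) y)
    rw [liftBracket_apply, hκl x hx, hκl y hy] at h1
    exact h1
  refine ⟨hω, fun a b => ?_⟩
  obtain ⟨Λ, hΛ⟩ := exists_isFormProduct (G := G) (κ := κ) hΩ a b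
  have hΛe := hΛ.isEquivariantProduct hΩ hinv' hκ
  have hI : IsInvariantConnection (homConnection G hκ Λ) :=
    fun g Y hY p v => homDeriv_pullField hκ hΛe g hY p v
  have hP := hasProduct_homConnection hr hπ hΩ hω hκ hκm hκl hΛ
  have h1 := preservesForm_iff hΩ hinv' hκ hΛ hne
  have h2 := isTorsionFree_iff hΩ hinv' hκ hΛ hne
  refine ⟨homConnection G hκ Λ, ⟨contMDiff_homConnection hκ hΛe (hasLocalSections_quotient hπ), hI,
    hP⟩, fun nabla' hI' hP' Y hY => ?_, h1, h2, ?_⟩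
  -- the products fix both connections on the fundamental fields of `𝔪` at the origin
  · refine eq_of_invariant n (o := ((1 : G) : G ⧸ H)) hI' hI (fun v => ⟨κ _ v,
      hκ.orbitDeriv_apply _ v, ?_⟩) hY
    refine ContinuousLinearMap.ext fun w => ?_
    have e := (hP' ⟨κ _ w, hκm w⟩ ⟨κ _ v, hκm v⟩).trans (hP ⟨κ _ w, hκm w⟩ ⟨κ _ v, hκm v⟩).symm
    have hw : fundamentalField d H (κ ((1 : G) : G ⧸ H) w) ((1 : G) : G ⧸ H) = w :=
      hκ.orbitDeriv_apply _ w
    have e' := sub_left_injective e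
    simp only [hw] at e'
    exact e'
  -- the lines `a = b` and `a = (1 - b) / 2` meet in one point
  · refine (and_congr h2 h1).trans ⟨fun ⟨h, h'⟩ => ?_, fun ⟨h, h'⟩ => ?_⟩
    · constructor <;> linarith
    · exact ⟨by rw [h, h']; norm_num, by rw [h, h']⟩
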